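/- Let $\mathbb{D}$ be the open unit disc in $\mathbb{C}$ and $\mathcal{H}(\mathbb{D})$ the space of analytic functions in $\mathbb{D}$; write $f(z)=\sum_{n\ge0}\widehat f(n)z^n$ and let $dA=\frac{dx\,dy}{\pi}$. For $0<p<\infty$ consider the following spaces of functions $f\in\mathcal{H}(\mathbb{D})$ for which the respective quantity is finite: the Hardy space $H^p$, with $\|f\|_{H^p}=\sup_{0<r<1}\left(\frac1{2\pi}\int_0^{2\pi}|f(re^{i\theta})|^p\,d\theta\right)^{1/p}$; the Dirichlet-type space $D^p_{p-1}$, with $\|f\|_{D^p_{p-1}}^p=\int_{\mathbb{D}}|f'(z)|^p(1-|z|)^{p-1}\,dA(z)+|f(0)|^p$; and the Hardy-Littlewood space $\mathrm{HL}_p$, with $\|f\|_{\mathrm{HL}_p}^p=\sum_{n=0}^\infty|\widehat f(n)|^p(n+1)^{p-2}$. Let $H^\infty$ be the space of bounded analytic functions in $\mathbb{D}$ with the supremum norm. For $g\in\mathcal{H}(\mathbb{D})$ let $T_g(f)(z)=\int_0^z f(\zeta)g'(\zeta)\,d\zeta$, $z\in\mathbb{D}$, and let $T(X,H^\infty)$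 (resp. $T_c(X,H^\infty)$) be the set of $g\in\mathcal{H}(\mathbb{D})$ such that $T_g:X\to H^\infty$ is bounded (resp. compact). Let $X_p$ denote one of $H^p$, $D^p_{p-1}$, $\mathrm{HL}_p$ (the same choice for all $p$). Then: (i) $T(X_1,H^\infty)$ contains all polynomials; (ii) if $0<p<1$, then $T(X_p,H^\infty)$ is exactly the set of constant functions; (iii) $T_c(X_1,H^\infty)$ is exactly the set of constant functions. -/

import Mathlib

open scoped ENNReal NNReal

namespace Volterra

/-- The space `H(𝔻)` of analytic functions in the open unit disc. Only the values in the disc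
matter in everything below. -/
def analyticDisc : Set (ℂ → ℂ) :=
  {f | DifferentiableOn ℂ f (Metric.ball 0 1)}

/-- The `n`-th Maclaurin coefficient of `f`. -/
noncomputable def maclaurin (f : ℂ → ℂ) (n : ℕ) : ℂ :=
  iteratedDeriv n f 0 / (n.factorial : ℂ)

/-- The integral mean `M_p(r, f)`, `0 < p < ∞`. -/
noncomputable def integralMean (p r : ℝ) (f : ℂ → ℂ) : ℝ≥0∞ :=
  (ENNReal.ofReal (1 / (2 * Real.pi)) *
    ∫⁻ θ in Set.Ioc (0 : ℝ) (2 * Real.pi),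
      ‖f ((r : ℂ) * Complex.exp ((θ : ℂ) * Complex.I))‖ₑ ^ p) ^ (1 / p)

/-- The (quasi)norm of the Hardy space `H^p`, `0 < p < ∞`, with value `∞` off the space. -/
noncomputable def hardyNorm (p : ℝ) (f : ℂ → ℂ) : ℝ≥0∞ :=
  ⨆ r ∈ Set.Ioo (0 : ℝ) 1, integralMean p r f

/-- The (quasi)norm of the Dirichlet-type space `D^p_{p-1}`, `0 < p < ∞`; the area measure
`dA = dx dy / π` is normalized. -/
noncomputable def dirichletNorm (p : ℝ) (f : ℂ → ℂ) : ℝ≥0∞ :=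
  (ENNReal.ofReal (1 / Real.pi) *
      (∫⁻ z in Metric.ball (0 : ℂ) 1, ‖deriv f z‖ₑ ^ p * ENNReal.ofReal ((1 - ‖z‖) ^ (p - 1)))
    + ‖f 0‖ₑ ^ p) ^ (1 / p)

/-- The (quasi)norm of the Hardy-Littlewood space `HL_p`, `0 < p < ∞`. -/
noncomputable def hardyLittlewoodNorm (p : ℝ) (f : ℂ → ℂ) : ℝ≥0∞ :=
  (∑' n : ℕ, ‖maclaurin f n‖ₑ ^ p * ENNReal.ofReal (((n : ℝ) + 1) ^ (p - 2))) ^ (1 / p)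

/-- The norm of `H^∞`. -/
noncomputable def hInfNorm (f : ℂ → ℂ) : ℝ≥0∞ :=
  ⨆ z ∈ Metric.ball (0 : ℂ) 1, ‖f z‖ₑ

/-- The space of those analytic functions in the disc for which the (quasi)norm `N` is finite. -/
def space (N : (ℂ → ℂ) → ℝ≥0∞) : Set (ℂ → ℂ) :=
  {f | f ∈ analyticDisc ∧ N f < ∞}

/-- The operator `T_g(f)(z) = ∫₀ᶻ f(ζ) g'(ζ) dζ`, with the integral along the segment `[0, z]`. -/
noncomputable def T (g f : ℂ → ℂ) (z : ℂ) : ℂ :=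
  z * ∫ t in (0 : ℝ)..1, f ((t : ℂ) * z) * deriv g ((t : ℂ) * z)

/-- `T_g` is a bounded operator from the space with (quasi)norm `N` into `H^∞`. -/
def IsBoundedT (N : (ℂ → ℂ) → ℝ≥0∞) (g : ℂ → ℂ) : Prop :=
  Set.MapsTo (T g) (space N) (space hInfNorm) ∧
    ∃ C : ℝ≥0, ∀ f ∈ space N, hInfNorm (T g f) ≤ (C : ℝ≥0∞) * N f

/-- `T_g` is a compact operator from the space with (quasi)norm `N` into `H^∞`: the image of every
bounded sequence has a subsequence that converges in `H^∞`. -/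
def IsCompactT (N : (ℂ → ℂ) → ℝ≥0∞) (g : ℂ → ℂ) : Prop :=
  Set.MapsTo (T g) (space N) (space hInfNorm) ∧
    ∀ u : ℕ → ℂ → ℂ, (∀ n, u n ∈ space N) → (∃ C : ℝ≥0, ∀ n, N (u n) ≤ (C : ℝ≥0∞)) →
      ∃ φ : ℕ → ℕ, StrictMono φ ∧ ∃ h ∈ space hInfNorm,
        Filter.Tendsto (fun k => hInfNorm (T g (u (φ k)) - h)) Filter.atTop (nhds 0)

/-- The set `T(X, H^∞)` of analytic symbols `g` such that `T_g : X → H^∞` is bounded, where `X` has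
the (quasi)norm `N`. -/
def boundedSymbols (N : (ℂ → ℂ) → ℝ≥0∞) : Set (ℂ → ℂ) :=
  {g | g ∈ analyticDisc ∧ IsBoundedT N g}

/-- The set `T_c(X, H^∞)` of analytic symbols `g` such that `T_g : X → H^∞` is compact, where `X`
has the (quasi)norm `N`. -/
def compactSymbols (N : (ℂ → ℂ) → ℝ≥0∞) : Set (ℂ → ℂ) :=
  {g | g ∈ analyticDisc ∧ IsCompactT N g}

/-- The functions that are constant in the unit disc. -/
def constants : Set (ℂ → ℂ) :=
  {g | ∃ c : ℂ, ∀ z ∈ Metric.ball (0 : ℂ) 1, g z = c}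

end Volterra

/-! The operator `T_g` is controlled through the fact that `T_g f` is the primitive of `f g'`
vanishing at the origin.

Assertion (i) holds for every analytic `g` with bounded derivative. For `HL_1`, integrate `∑ |f̂(n)|
t^n` along a radius: `∫₀¹ t^n dt = 1/(n+1)` is exactly the weight of the norm. For `H^1`,
integration by parts on a circle expresses a primitive through its derivative with a bounded kernel
(`two_pi_mul_eq_circle_integral`), so `|T_g f(z)|` is at most a constant times the integral mean of
`f` over the circle through `z`. For `D^1_0`, integrating `f'` along radii shows that the space
embeds in `H^1`.

Assertions (ii) and (iii) come from test functions `f_{n,ζ}` of bounded norm with `(1 - r_n)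
|f_{n,ζ}(r_n ζ)| ≥ c_n`, where `r_n → 1` and `c_n` is comparable to `(n+2)^(1/p-1)`. Cauchy's
estimate for `(T_g f)' = f g'` gives `c_n |g'(r_n ζ)| ≤ 2 ‖T_g f_{n,ζ}‖_∞`. If `p < 1`, then `c_n →
∞`, and the maximum principle forces `g' = 0`. If `p = 1`, then `c_n` is a positive constant; the
test functions tend to zero locally uniformly, so compactness yields a subsequence with `‖T_g f‖_∞ →
0`, and again `g' = 0`. Normalized monomials serve for `HL_p`, and normalized powers of the Cauchy
kernel for `H^p` and `D^p_{p-1}`. -/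

namespace Volterra

/-! ### `T_g f` as a primitive, and Cauchy's estimate for it. -/

section Primitive

variable {f g : ℂ → ℂ}

lemma deriv_mem_analyticDisc (hg : g ∈ analyticDisc) : deriv g ∈ analyticDisc :=
  DifferentiableOn.deriv hg Metric.isOpen_ball

lemma differentiableAt_of_mem_analyticDisc (hg : g ∈ analyticDisc) {z : ℂ} (hz : ‖z‖ < 1) :
    DifferentiableAt ℂ g z :=
  DifferentiableOn.differentiableAt hg (Metric.isOpen_ball.mem_nhds (by simpa using hz))

lemma norm_real_mul_lt_one {z : ℂ} (hz : ‖z‖ < 1) {t : ℝ} (ht : t ∈ Set.Icc (0 : ℝ) 1) :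
    ‖(t : ℂ) * z‖ < 1 := by
  rw [norm_mul, Complex.norm_real, Real.norm_of_nonneg ht.1]
  nlinarith [ht.1, ht.2, norm_nonneg z]

/-- Inside the disc, `T_g f` is the primitive of `f g'` that vanishes at the origin. -/
lemma hasDerivAt_T (hf : f ∈ analyticDisc) (hg : g ∈ analyticDisc) {z : ℂ} (hz : ‖z‖ < 1) :
    HasDerivAt (T g f) (f z * deriv g z) z := by
  have hfg : DifferentiableOn ℂ (fun w => f w * deriv g w) (Metric.ball 0 1) :=
    DifferentiableOn.mul hf (deriv_mem_analyticDisc hg)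
  obtain ⟨F, hF⟩ := hfg.isExactOn_ball
  have key : ∀ w ∈ Metric.ball (0 : ℂ) 1, T g f w = F w - F 0 := by
    intro w hw
    have hw' : ‖w‖ < 1 := by simpa using hw
    have hmem : ∀ t ∈ Set.uIcc (0 : ℝ) 1, (t : ℂ) * w ∈ Metric.ball (0 : ℂ) 1 := by
      intro t ht
      rw [Set.uIcc_of_le zero_le_one] at ht
      simpa using norm_real_mul_lt_one hw' ht
    have h1 : ∀ t ∈ Set.uIcc (0 : ℝ) 1, HasDerivAt (fun t : ℝ => F ((t : ℂ) * w))
        (f ((t : ℂ) * w) * deriv g ((t : ℂ) * w) * w) t := by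
      intro t ht
      have h2 : HasDerivAt (fun t : ℝ => (t : ℂ) * w) w t := by
        simpa using (Complex.ofRealCLM.hasDerivAt (x := t)).mul_const w
      exact HasDerivAt.comp t (h := fun t : ℝ => (t : ℂ) * w) (hF _ (hmem t ht)) h2
    have hcont : ContinuousOn (fun t : ℝ => f ((t : ℂ) * w) * deriv g ((t : ℂ) * w) * w)
        (Set.uIcc 0 1) :=
      (hfg.continuousOn.comp (by fun_prop) hmem).mul continuousOn_const
    have h3 := intervalIntegral.integral_eq_sub_of_hasDerivAt h1 hcont.intervalIntegrable
    rw [intervalIntegral.integral_mul_const] at h3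
    rw [T, mul_comm, h3]
    simp
  have hz' : z ∈ Metric.ball (0 : ℂ) 1 := by simpa using hz
  exact ((hF z hz').sub_const (F 0)).congr_of_eventuallyEq
    (Filter.eventuallyEq_of_mem (Metric.isOpen_ball.mem_nhds hz') key)

lemma T_mem_analyticDisc (hf : f ∈ analyticDisc) (hg : g ∈ analyticDisc) :
    T g f ∈ analyticDisc := fun z hz =>
  (hasDerivAt_T hf hg (by simpa using hz)).differentiableAt.differentiableWithinAt

lemma T_apply_zero : T g f 0 = 0 := by simp [T]

lemma enorm_le_hInfNorm {z : ℂ} (hz : ‖z‖ < 1) : ‖f z‖ₑ ≤ hInfNorm f :=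
  le_iSup₂ (f := fun z (_ : z ∈ Metric.ball (0 : ℂ) 1) => ‖f z‖ₑ) z (by simpa using hz)

lemma hInfNorm_le {K : ℝ≥0∞} (h : ∀ z : ℂ, ‖z‖ < 1 → ‖f z‖ₑ ≤ K) : hInfNorm f ≤ K :=
  iSup₂_le fun z hz => h z (by simpa using hz)

lemma isBoundedT_of_enorm_le {N : (ℂ → ℂ) → ℝ≥0∞} (hg : g ∈ analyticDisc) (C : ℝ≥0)
    (h : ∀ f ∈ space N, ∀ z : ℂ, ‖z‖ < 1 → ‖T g f z‖ₑ ≤ C * N f) : IsBoundedT N g :=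
  ⟨fun f hf => ⟨T_mem_analyticDisc hf.1 hg,
    (hInfNorm_le (h f hf)).trans_lt (ENNReal.mul_lt_top ENNReal.coe_lt_top hf.2)⟩,
    C, fun f hf => hInfNorm_le (h f hf)⟩

/-- Cauchy's estimate for `(T_g f)' = f g'` on the disc of radius `(1 - ‖z‖) / 2` about `z`; halving
the radius keeps the closed disc inside `𝔻` and costs the factor 2. -/
lemma norm_mul_deriv_le_of_hInfNorm_le (hf : f ∈ analyticDisc) (hg : g ∈ analyticDisc) {K : ℝ}
    (hK : 0 ≤ K) (h : hInfNorm (T g f) ≤ ENNReal.ofReal K) {z : ℂ} (hz : ‖z‖ < 1) :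
    (1 - ‖z‖) * (‖f z‖ * ‖deriv g z‖) ≤ 2 * K := by
  have hR : 0 < (1 - ‖z‖) / 2 := by linarith
  have hsub : ∀ w ∈ Metric.closedBall z ((1 - ‖z‖) / 2), ‖w‖ < 1 := by
    intro w hw
    have h1 : ‖w - z‖ ≤ (1 - ‖z‖) / 2 := by simpa [dist_eq_norm] using hw
    have h2 := norm_add_le (w - z) z
    rw [sub_add_cancel] at h2
    linarith
  have hd : DiffContOnCl ℂ (T g f) (Metric.ball z ((1 - ‖z‖) / 2)) := by
    refine DifferentiableOn.diffContOnCl fun w hw => ?_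
    rw [closure_ball _ hR.ne'] at hw
    exact (differentiableAt_of_mem_analyticDisc (T_mem_analyticDisc hf hg) (hsub w hw)).differentiableWithinAt
  have h3 := Complex.norm_deriv_le_of_forall_mem_sphere_norm_le (C := K) hR hd (fun w hw => by
    have h4 := (enorm_le_hInfNorm (hsub w (Metric.sphere_subset_closedBall hw))).trans h
    rwa [← ofReal_norm, ENNReal.ofReal_le_ofReal_iff hK] at h4)
  rw [(hasDerivAt_T hf hg hz).deriv, norm_mul, le_div_iff₀ hR] at h3
  linarith

end Primitive

/-! ### Constant symbols. -/

section Constants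

variable {N : (ℂ → ℂ) → ℝ≥0∞} {g : ℂ → ℂ}

lemma constants_subset_analyticDisc : constants ⊆ analyticDisc := by
  rintro g ⟨c, hc⟩
  exact (differentiableOn_const c).congr hc

lemma deriv_eq_zero_of_mem_constants (hg : g ∈ constants) {z : ℂ} (hz : ‖z‖ < 1) :
    deriv g z = 0 := by
  obtain ⟨c, hc⟩ := hg
  have : g =ᶠ[nhds z] fun _ => c :=
    Filter.eventuallyEq_of_mem (Metric.isOpen_ball.mem_nhds (by simpa using hz)) hc
  rw [this.deriv_eq, deriv_const]

lemma mem_constants_of_deriv_eq_zero (hg : g ∈ analyticDisc)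
    (h : ∀ z : ℂ, ‖z‖ < 1 → deriv g z = 0) : g ∈ constants :=
  ⟨g 0, fun _ hz => Metric.isOpen_ball.is_const_of_deriv_eq_zero
    (convex_ball (0 : ℂ) 1).isPreconnected hg (fun w hw => h w (by simpa using hw)) hz (by simp)⟩

lemma T_eq_zero_of_mem_constants (hg : g ∈ constants) (f : ℂ → ℂ) {z : ℂ} (hz : ‖z‖ < 1) :
    T g f z = 0 := by
  have : Set.EqOn (fun t : ℝ => f ((t : ℂ) * z) * deriv g ((t : ℂ) * z)) (fun _ => 0)
      (Set.uIcc 0 1) := by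
    intro t ht
    rw [Set.uIcc_of_le zero_le_one] at ht
    simp [deriv_eq_zero_of_mem_constants hg (norm_real_mul_lt_one hz ht)]
  rw [T, intervalIntegral.integral_congr this]
  simp

lemma constants_subset_boundedSymbols : constants ⊆ boundedSymbols N := fun _ hg =>
  ⟨constants_subset_analyticDisc hg, isBoundedT_of_enorm_le (constants_subset_analyticDisc hg) 0
    fun f _ z hz => by simp [T_eq_zero_of_mem_constants hg f hz]⟩

lemma constants_subset_compactSymbols : constants ⊆ compactSymbols N := fun g hg =>
  ⟨constants_subset_analyticDisc hg, (constants_subset_boundedSymbols hg).2.1, fun u _ _ =>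
    ⟨id, strictMono_id, 0, ⟨differentiableOn_const 0, by simp [hInfNorm]⟩, by
      have : ∀ k, hInfNorm (T g (u (id k)) - 0) = 0 := fun k =>
        le_antisymm (hInfNorm_le fun z hz => by
          simp [T_eq_zero_of_mem_constants hg (u k) hz]) bot_le
      simp only [this]
      exact tendsto_const_nhds⟩⟩

end Constants

/-! ### Test families and the necessity arguments. -/

section TestFamilies

/-- The radius at which the `n`-th test functions are evaluated. -/
noncomputable def testRadius (n : ℕ) : ℝ := 1 - 1 / ((n : ℝ) + 2)

lemma testRadius_pos (n : ℕ) : 0 < testRadius n := by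
  rw [testRadius, sub_pos, div_lt_one (by positivity)]
  linarith [Nat.cast_nonneg (α := ℝ) n]

lemma testRadius_lt_one (n : ℕ) : testRadius n < 1 := by
  rw [testRadius]
  have : 0 < 1 / ((n : ℝ) + 2) := by positivity
  linarith

lemma tendsto_testRadius : Filter.Tendsto testRadius Filter.atTop (nhds 1) := by
  have h : Filter.Tendsto (fun n : ℕ => 1 / ((n : ℝ) + 2)) Filter.atTop (nhds 0) := by
    have := (tendsto_one_div_add_atTop_nhds_zero_nat (𝕜 := ℝ)).comp (Filter.tendsto_add_atTop_nat 1)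
    refine this.congr fun n => ?_
    simp only [Function.comp_apply]; push_cast; ring
  have h' := h.const_sub 1
  rwa [sub_zero] at h'

/-- Analytic functions `f n ζ`, with `‖ζ‖ = 1`, of bounded (quasi)norm, tending to zero locally
uniformly, and of size at least `c n / (1 - r)` at `r ζ`, where `r` is the `n`-th test radius. -/
structure IsTestFamily (N : (ℂ → ℂ) → ℝ≥0∞) (c : ℕ → ℝ) (C : ℝ≥0) (f : ℕ → ℂ → ℂ → ℂ) : Prop where
  analytic : ∀ n ζ, ‖ζ‖ = 1 → f n ζ ∈ analyticDisc
  norm_le : ∀ n ζ, ‖ζ‖ = 1 → N (f n ζ) ≤ C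
  le_apply : ∀ n ζ, ‖ζ‖ = 1 →
    c n ≤ (1 - testRadius n) * ‖f n ζ ((testRadius n : ℂ) * ζ)‖
  vanish : ∀ R : ℝ, 0 < R → R < 1 → ∃ ε : ℕ → ℝ, Filter.Tendsto ε Filter.atTop (nhds 0) ∧
    ∀ n ζ w, ‖ζ‖ = 1 → ‖w‖ ≤ R → ‖f n ζ w‖ ≤ ε n

variable {N : (ℂ → ℂ) → ℝ≥0∞} {c : ℕ → ℝ} {C : ℝ≥0} {f : ℕ → ℂ → ℂ → ℂ} {g : ℂ → ℂ}

lemma norm_testRadius_mul (n : ℕ) {ζ : ℂ} (hζ : ‖ζ‖ = 1) :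
    ‖(testRadius n : ℂ) * ζ‖ = testRadius n := by
  rw [norm_mul, hζ, mul_one, Complex.norm_real, Real.norm_of_nonneg (testRadius_pos n).le]

lemma IsTestFamily.mem_space (hf : IsTestFamily N c C f) {n : ℕ} {ζ : ℂ} (hζ : ‖ζ‖ = 1) :
    f n ζ ∈ space N :=
  ⟨hf.analytic n ζ hζ, (hf.norm_le n ζ hζ).trans_lt ENNReal.coe_lt_top⟩

lemma IsTestFamily.mul_norm_deriv_le (hf : IsTestFamily N c C f) (hg : g ∈ analyticDisc) {n : ℕ}
    {ζ : ℂ} (hζ : ‖ζ‖ = 1) {K : ℝ} (hK : 0 ≤ K)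
    (h : hInfNorm (T g (f n ζ)) ≤ ENNReal.ofReal K) :
    c n * ‖deriv g ((testRadius n : ℂ) * ζ)‖ ≤ 2 * K := by
  have h1 := norm_mul_deriv_le_of_hInfNorm_le (hf.analytic n ζ hζ) hg hK h
    (z := (testRadius n : ℂ) * ζ) (by rw [norm_testRadius_mul n hζ]; exact testRadius_lt_one n)
  rw [norm_testRadius_mul n hζ, ← mul_assoc] at h1
  exact (mul_le_mul_of_nonneg_right (hf.le_apply n ζ hζ) (norm_nonneg _)).trans h1

/-- Maximum principle on the circles of the test radii. -/
lemma norm_le_of_forall_testRadius {F : ℂ → ℂ} (hF : F ∈ analyticDisc) {n : ℕ} {K : ℝ}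
    (h : ∀ ζ : ℂ, ‖ζ‖ = 1 → ‖F ((testRadius n : ℂ) * ζ)‖ ≤ K) {z : ℂ} (hz : ‖z‖ ≤ testRadius n) :
    ‖F z‖ ≤ K := by
  have hr := testRadius_pos n
  have hd : DiffContOnCl ℂ F (Metric.ball 0 (testRadius n)) := by
    refine DifferentiableOn.diffContOnCl fun w hw => ?_
    rw [closure_ball _ hr.ne', mem_closedBall_zero_iff] at hw
    exact (differentiableAt_of_mem_analyticDisc hF (hw.trans_lt (testRadius_lt_one n))).differentiableWithinAt
  refine Complex.norm_le_of_forall_mem_frontier_norm_le Metric.isBounded_ball hd (fun w hw => ?_)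
    (by rw [closure_ball _ hr.ne']; simpa using hz)
  rw [frontier_ball _ hr.ne', mem_sphere_zero_iff_norm] at hw
  have hne : (testRadius n : ℂ) ≠ 0 := by exact_mod_cast hr.ne'
  have := h (w / (testRadius n : ℂ)) (by
    rw [norm_div, hw, Complex.norm_real, Real.norm_of_nonneg hr.le, div_self hr.ne'])
  rwa [mul_div_cancel₀ _ hne] at this

/-- For fixed `z`, the maximum principle carries the bound `2 B C / c n` from the circle of radius
`testRadius n` to `|g'(z)|`, and this bound tends to zero. -/
lemma IsTestFamily.boundedSymbols_eq (hf : IsTestFamily N c C f)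
    (hc : Filter.Tendsto c Filter.atTop Filter.atTop) : boundedSymbols N = constants := by
  refine Set.Subset.antisymm ?_ constants_subset_boundedSymbols
  rintro g ⟨hg, -, B, hB⟩
  refine mem_constants_of_deriv_eq_zero hg fun z hz => norm_le_zero_iff.1 ?_
  have hlim : Filter.Tendsto (fun n => 2 * ((B : ℝ) * C) / c n) Filter.atTop (nhds 0) :=
    tendsto_const_nhds.div_atTop hc
  refine ge_of_tendsto hlim ?_
  filter_upwards [hc.eventually_gt_atTop 0, tendsto_testRadius.eventually_const_lt hz] with n hn hzn
  refine norm_le_of_forall_testRadius (deriv_mem_analyticDisc hg) (fun ζ hζ => ?_) hzn.le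
  rw [le_div_iff₀' hn]
  refine hf.mul_norm_deriv_le hg hζ (by positivity) ((hB _ (hf.mem_space hζ)).trans ?_)
  rw [ENNReal.ofReal_mul (by positivity), ENNReal.ofReal_coe_nnreal, ENNReal.ofReal_coe_nnreal]
  gcongr
  exact hf.norm_le n ζ hζ

lemma IsTestFamily.tendsto_T (hf : IsTestFamily N c C f) (hg : g ∈ analyticDisc) {ζ : ℕ → ℂ}
    (hζ : ∀ n, ‖ζ n‖ = 1) {z : ℂ} (hz : ‖z‖ < 1) :
    Filter.Tendsto (fun n => T g (f n (ζ n)) z) Filter.atTop (nhds 0) := by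
  obtain ⟨R, hzR, hR⟩ := exists_between hz
  have hR0 : 0 < R := (norm_nonneg z).trans_lt hzR
  obtain ⟨ε, hε, hfε⟩ := hf.vanish R hR0 hR
  obtain ⟨M, hM⟩ := (isCompact_closedBall (0 : ℂ) R).exists_bound_of_continuousOn
    (f := deriv g) ((DifferentiableOn.continuousOn (deriv_mem_analyticDisc hg)).mono fun w hw => by
      rw [mem_closedBall_zero_iff] at hw
      simpa using hw.trans_lt hR)
  have hlim : Filter.Tendsto (fun n => ‖z‖ * (ε n * M)) Filter.atTop (nhds 0) := by
    simpa using (hε.mul_const M).const_mul ‖z‖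
  refine squeeze_zero_norm (fun n => ?_) hlim
  rw [T, norm_mul]
  gcongr
  have h1 : ∀ t ∈ Set.uIoc (0 : ℝ) 1,
      ‖f n (ζ n) ((t : ℂ) * z) * deriv g ((t : ℂ) * z)‖ ≤ ε n * M := by
    intro t ht
    rw [Set.uIoc_of_le zero_le_one] at ht
    have h2 : ‖(t : ℂ) * z‖ ≤ R := by
      rw [norm_mul, Complex.norm_real, Real.norm_of_nonneg ht.1.le]
      nlinarith [ht.1, ht.2, norm_nonneg z]
    rw [norm_mul]
    have h3 := hfε n (ζ n) _ (hζ n) h2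
    exact mul_le_mul h3 (hM _ (by simpa using h2)) (norm_nonneg _) ((norm_nonneg _).trans h3)
  simpa using intervalIntegral.norm_integral_le_of_norm_le_const h1

/-- The images tend to zero pointwise, so the only possible limit in `H^∞` is zero; but where `g'`
stays away from zero, Cauchy's estimate keeps their norms away from zero. -/
lemma IsTestFamily.compactSymbols_eq {κ : ℝ} (hκ : 0 < κ)
    (hf : IsTestFamily N (fun _ => κ) C f) : compactSymbols N = constants := by
  refine Set.Subset.antisymm ?_ constants_subset_compactSymbols
  rintro g ⟨hg, -, hcomp⟩
  refine mem_constants_of_deriv_eq_zero hg fun z hz => ?_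
  by_contra hne
  set c₀ := ‖deriv g z‖ / 2 with hc₀
  have hc₀pos : 0 < c₀ := by rw [hc₀]; positivity
  -- By the maximum principle `|g'|` cannot stay below `|g'(z)| / 2` on a circle enclosing `z`. For
  -- the finitely many `n` with `testRadius n < ‖z‖` nothing is required of `ζ`.
  have hex : ∀ n, ∃ ζ : ℂ, ‖ζ‖ = 1 ∧
      (‖z‖ ≤ testRadius n → c₀ ≤ ‖deriv g ((testRadius n : ℂ) * ζ)‖) := by
    intro n
    by_contra! hcon
    have h1 := hcon 1 (by simp)
    have := norm_le_of_forall_testRadius (deriv_mem_analyticDisc hg) (fun ζ hζ => (hcon ζ hζ).2.le) h1.1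
    linarith [hc₀]
  choose ζ hζ hζ' using hex
  obtain ⟨φ, hφ, h, -, hlim⟩ := hcomp (fun n => f n (ζ n)) (fun n => hf.mem_space (hζ n))
    ⟨C, fun n => hf.norm_le n _ (hζ n)⟩
  have hzero : ∀ w : ℂ, ‖w‖ < 1 → h w = 0 := by
    intro w hw
    have h1 : Filter.Tendsto (fun k => ‖(T g (f (φ k) (ζ (φ k))) - h) w‖ₑ) Filter.atTop (nhds 0) :=
      tendsto_of_tendsto_of_tendsto_of_le_of_le tendsto_const_nhds hlim (fun _ => bot_le)
        fun k => enorm_le_hInfNorm hw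
    have h2 : Filter.Tendsto (fun k => ‖(T g (f (φ k) (ζ (φ k))) - h) w‖ₑ) Filter.atTop
        (nhds ‖0 - h w‖ₑ) :=
      (((hf.tendsto_T hg hζ hw).comp hφ.tendsto_atTop).sub_const (h w)).enorm
    simpa using tendsto_nhds_unique h2 h1
  have hnorm : ∀ k, hInfNorm (T g (f (φ k) (ζ (φ k)))) ≤
      hInfNorm (T g (f (φ k) (ζ (φ k))) - h) := fun k => hInfNorm_le fun w hw => by
    refine le_trans (le_of_eq ?_) (enorm_le_hInfNorm hw)
    rw [Pi.sub_apply, hzero w hw, sub_zero]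
  -- Cauchy's estimate doubles this value, and `κ c₀ / 2` is still smaller than `κ c₀`.
  have hK : 0 < κ * c₀ / 4 := by positivity
  obtain ⟨k, hk1, hk2⟩ := ((hlim.eventually_le_const (ENNReal.ofReal_pos.2 hK)).and
    ((tendsto_testRadius.comp hφ.tendsto_atTop).eventually_const_lt hz)).exists
  have h3 := hf.mul_norm_deriv_le hg (hζ (φ k)) hK.le ((hnorm k).trans hk1)
  have h4 := mul_le_mul_of_nonneg_left (hζ' (φ k) hk2.le) hκ.le
  have : 0 < κ * c₀ := by positivity
  linarith

end TestFamilies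

/-! ### Sufficiency for `HL_1`. -/

section HardyLittlewood

lemma hardyLittlewoodNorm_one (f : ℂ → ℂ) : hardyLittlewoodNorm 1 f =
    ∑' n : ℕ, ‖maclaurin f n‖ₑ * ENNReal.ofReal (1 / ((n : ℝ) + 1)) := by
  rw [hardyLittlewoodNorm, div_one, ENNReal.rpow_one]
  refine tsum_congr fun n => ?_
  rw [ENNReal.rpow_one, show (1 : ℝ) - 2 = -1 by norm_num, Real.rpow_neg_one, one_div]

lemma hasSum_maclaurin {f : ℂ → ℂ} (hf : f ∈ analyticDisc) {z : ℂ} (hz : ‖z‖ < 1) :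
    HasSum (fun n => maclaurin f n * z ^ n) (f z) := by
  have := Complex.hasSum_taylorSeries_on_ball hf (z := z) (by simpa using hz)
  refine this.congr_fun fun n => ?_
  simp only [sub_zero, smul_eq_mul, maclaurin]
  ring

lemma enorm_le_tsum_maclaurin {f : ℂ → ℂ} (hf : f ∈ analyticDisc) {z : ℂ} (hz : ‖z‖ < 1) :
    ‖f z‖ₑ ≤ ∑' n, ‖maclaurin f n‖ₑ * ‖z‖ₑ ^ n := by
  rw [← (hasSum_maclaurin hf hz).tsum_eq]
  refine enorm_tsum_le_tsum_enorm.trans (le_of_eq (tsum_congr fun n => ?_))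
  rw [enorm_mul, enorm_pow]

lemma lintegral_pow_Ioc (n : ℕ) :
    ∫⁻ t in Set.Ioc (0 : ℝ) 1, ENNReal.ofReal (t ^ n) = ENNReal.ofReal (1 / ((n : ℝ) + 1)) := by
  rw [← MeasureTheory.ofReal_integral_eq_lintegral_ofReal]
  · rw [← intervalIntegral.integral_of_le zero_le_one, integral_pow]
    simp
  · exact (intervalIntegral.intervalIntegrable_pow n).1
  · filter_upwards [MeasureTheory.ae_restrict_mem measurableSet_Ioc] with t ht
    exact pow_nonneg ht.1.le n

lemma enorm_T_le_lintegral_segment {f g : ℂ → ℂ} {M : ℝ≥0}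
    (hM : ∀ z : ℂ, ‖z‖ < 1 → ‖deriv g z‖ₑ ≤ M) {z : ℂ} (hz : ‖z‖ < 1) :
    ‖T g f z‖ₑ ≤ M * ∫⁻ t in Set.Ioc (0 : ℝ) 1, ‖f ((t : ℂ) * z)‖ₑ := by
  have hz1 : ‖z‖ₑ ≤ 1 := by
    rw [← ofReal_norm]; exact ENNReal.ofReal_le_one.2 hz.le
  calc ‖T g f z‖ₑ ≤ ‖∫ t in (0 : ℝ)..1, f ((t : ℂ) * z) * deriv g ((t : ℂ) * z)‖ₑ := by
        rw [T, enorm_mul]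
        exact mul_le_of_le_one_left bot_le hz1
    _ ≤ ∫⁻ t in Set.Ioc (0 : ℝ) 1, ‖f ((t : ℂ) * z) * deriv g ((t : ℂ) * z)‖ₑ := by
        rw [intervalIntegral.integral_of_le zero_le_one]
        exact MeasureTheory.enorm_integral_le_lintegral_enorm _
    _ ≤ ∫⁻ t in Set.Ioc (0 : ℝ) 1, M * ‖f ((t : ℂ) * z)‖ₑ := by
        refine MeasureTheory.setLIntegral_mono_ae' measurableSet_Ioc (.of_forall fun t ht => ?_)
        rw [enorm_mul, mul_comm]
        gcongr
        exact hM _ (norm_real_mul_lt_one hz (Set.Ioc_subset_Icc_self ht))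
    _ = _ := MeasureTheory.lintegral_const_mul' _ _ ENNReal.coe_ne_top

lemma isBoundedT_hardyLittlewood_one {g : ℂ → ℂ} (hg : g ∈ analyticDisc) {M : ℝ≥0}
    (hM : ∀ z : ℂ, ‖z‖ < 1 → ‖deriv g z‖ₑ ≤ M) : IsBoundedT (hardyLittlewoodNorm 1) g := by
  refine isBoundedT_of_enorm_le hg M fun f hf z hz => (enorm_T_le_lintegral_segment hM hz).trans ?_
  gcongr
  calc ∫⁻ t in Set.Ioc (0 : ℝ) 1, ‖f ((t : ℂ) * z)‖ₑ
      ≤ ∫⁻ t in Set.Ioc (0 : ℝ) 1, ∑' n, ‖maclaurin f n‖ₑ * ENNReal.ofReal (t ^ n) := by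
        refine MeasureTheory.setLIntegral_mono_ae' measurableSet_Ioc (.of_forall fun t ht => ?_)
        refine (enorm_le_tsum_maclaurin hf.1
          (norm_real_mul_lt_one hz (Set.Ioc_subset_Icc_self ht))).trans ?_
        gcongr with n
        rw [← ofReal_norm, ← ENNReal.ofReal_pow (norm_nonneg _)]
        gcongr
        rw [norm_mul, Complex.norm_real, Real.norm_of_nonneg ht.1.le]
        nlinarith [ht.1, norm_nonneg z]
    _ = hardyLittlewoodNorm 1 f := by
        rw [MeasureTheory.lintegral_tsum (fun n => by fun_prop), hardyLittlewoodNorm_one]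
        refine tsum_congr fun n => ?_
        rw [MeasureTheory.lintegral_const_mul' _ _ enorm_ne_top, lintegral_pow_Ioc]

end HardyLittlewood

/-! ### Periodicity and rotation invariance on circles. -/

section Circle

/-- The integral of a periodic function over a period does not depend on the period chosen. -/
lemma lintegral_Ioc_add_period {F : ℝ → ℝ≥0∞} {P : ℝ} (hP : 0 < P) (hF : Function.Periodic F P)
    (a b : ℝ) : ∫⁻ θ in Set.Ioc a (a + P), F θ = ∫⁻ θ in Set.Ioc b (b + P), F θ := by
  refine MeasureTheory.IsAddFundamentalDomain.setLIntegral_eq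
    (G := AddSubgroup.zmultiples P) (isAddFundamentalDomain_Ioc hP a)
    (isAddFundamentalDomain_Ioc hP b) F ?_
  rintro ⟨_, k, rfl⟩ x
  have := (hF.zsmul k) x
  change F (k • P + x) = F x
  rwa [add_comm]

lemma periodic_exp_mul_I {α : Type*} (F : ℂ → α) (z : ℂ) :
    Function.Periodic (fun θ : ℝ => F (z * Complex.exp (θ * Complex.I))) (2 * Real.pi) := by
  intro θ
  simp only
  congr 2
  push_cast
  rw [add_mul, Complex.exp_add, Complex.exp_two_pi_mul_I, mul_one]

/-- Rotation invariance of the arc length. -/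
lemma lintegral_circle_rotate (F : ℂ → ℝ≥0∞) (z : ℂ) :
    ∫⁻ θ in Set.Ioc (0 : ℝ) (2 * Real.pi), F (z * Complex.exp (θ * Complex.I)) =
      ∫⁻ θ in Set.Ioc (0 : ℝ) (2 * Real.pi), F ((‖z‖ : ℂ) * Complex.exp (θ * Complex.I)) := by
  set α := z.arg
  have h1 : ∀ θ : ℝ, F (z * Complex.exp (θ * Complex.I)) =
      F ((‖z‖ : ℂ) * Complex.exp (((θ + α : ℝ) : ℂ) * Complex.I)) := by
    intro θ
    conv_lhs => rw [← Complex.norm_mul_exp_arg_mul_I z]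
    congr 1
    rw [mul_assoc, ← Complex.exp_add]
    push_cast
    congr 2
    ring
  simp_rw [h1]
  have h2 := (MeasureTheory.measurePreserving_add_right
    (MeasureTheory.volume : MeasureTheory.Measure ℝ) α).setLIntegral_comp_preimage_emb
    (MeasurableEquiv.addRight α).measurableEmbedding
    (fun θ => F ((‖z‖ : ℂ) * Complex.exp ((θ : ℂ) * Complex.I))) (Set.Ioc α (α + 2 * Real.pi))
  have h3 : (fun θ => θ + α) ⁻¹' Set.Ioc α (α + 2 * Real.pi) = Set.Ioc 0 (2 * Real.pi) := by
    ext θ; simp [add_comm α]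
  rw [h3] at h2
  rw [h2, lintegral_Ioc_add_period Real.two_pi_pos (periodic_exp_mul_I F _) α 0, zero_add]

end Circle

/-! ### Sufficiency for `H^1`. -/

section Hardy

lemma integralMean_one (r : ℝ) (f : ℂ → ℂ) : integralMean 1 r f =
    ENNReal.ofReal (1 / (2 * Real.pi)) * ∫⁻ θ in Set.Ioc (0 : ℝ) (2 * Real.pi),
      ‖f ((r : ℂ) * Complex.exp ((θ : ℂ) * Complex.I))‖ₑ := by
  simp [integralMean]

/-- A primitive on the disc, written as an integral of its derivative over a full circle. -/
lemma two_pi_mul_eq_circle_integral {F F' : ℂ → ℂ} (hF : ∀ z : ℂ, ‖z‖ < 1 → HasDerivAt F (F' z) z)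
    (hF' : F' ∈ analyticDisc) (hF0 : F 0 = 0) {z : ℂ} (hz : ‖z‖ < 1) :
    2 * Real.pi * F z = -∫ θ in (0 : ℝ)..2 * Real.pi, ((Real.pi - θ : ℝ) : ℂ) *
      (F' (z * Complex.exp (θ * Complex.I)) * (z * (Complex.exp (θ * Complex.I) * Complex.I))) := by
  have hmem : ∀ θ : ℝ, ‖z * Complex.exp (θ * Complex.I)‖ < 1 := fun θ => by
    rwa [norm_mul, Complex.norm_exp_ofReal_mul_I, mul_one]
  have hexp : ∀ θ : ℝ, HasDerivAt (fun θ : ℝ => z * Complex.exp (θ * Complex.I))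
      (z * (Complex.exp (θ * Complex.I) * Complex.I)) θ := fun θ => by
    have h1 : HasDerivAt (fun θ : ℝ => (θ : ℂ) * Complex.I) Complex.I θ := by
      simpa using (Complex.ofRealCLM.hasDerivAt (x := θ)).mul_const Complex.I
    exact h1.cexp.const_mul z
  have hv : ∀ θ ∈ Set.uIcc 0 (2 * Real.pi),
      HasDerivAt (fun θ : ℝ => F (z * Complex.exp (θ * Complex.I)))
      (F' (z * Complex.exp (θ * Complex.I)) * (z * (Complex.exp (θ * Complex.I) * Complex.I))) θ :=
    fun θ _ => HasDerivAt.comp θ (h := fun θ : ℝ => z * Complex.exp (θ * Complex.I))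
      (hF _ (hmem θ)) (hexp θ)
  have hu : ∀ θ ∈ Set.uIcc 0 (2 * Real.pi),
      HasDerivAt (fun θ : ℝ => ((Real.pi - θ : ℝ) : ℂ)) (-1 : ℂ) θ := fun θ _ => by
    have := ((hasDerivAt_id θ).const_sub Real.pi).ofReal_comp
    simpa using this
  have hcont : Continuous fun θ : ℝ => F' (z * Complex.exp (θ * Complex.I)) *
      (z * (Complex.exp (θ * Complex.I) * Complex.I)) := by
    refine Continuous.mul ?_ (by fun_prop)
    exact (DifferentiableOn.continuousOn hF').comp_continuous (by fun_prop)
      fun θ => by simpa using hmem θ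
  -- The factor `π - θ` runs from `π` to `-π`, so the boundary terms add up to `-2π F(z)`; the
  -- remaining integral is a multiple of the mean value `F 0 = 0`.
  have hparts := intervalIntegral.integral_mul_deriv_eq_deriv_mul hu hv
    (continuous_const.intervalIntegrable _ _) (hcont.intervalIntegrable _ _)
  have hmean : ∫ θ in (0 : ℝ)..2 * Real.pi, F (z * Complex.exp (θ * Complex.I)) = 0 := by
    have hd : DiffContOnCl ℂ (fun w => F (z * w)) (Metric.ball 0 |1|) := by
      refine DifferentiableOn.diffContOnCl fun w hw => ?_
      rw [abs_one, closure_ball _ one_ne_zero, mem_closedBall_zero_iff] at hw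
      have h1 : ‖z * w‖ < 1 := by
        rw [norm_mul]
        nlinarith [norm_nonneg z]
      exact ((hF _ h1).comp w ((hasDerivAt_id w).const_mul z)).differentiableAt.differentiableWithinAt
    have h2 := hd.circleAverage
    rw [Real.circleAverage, mul_zero, hF0] at h2
    simpa [circleMap, Real.pi_ne_zero] using h2
  rw [hparts, intervalIntegral.integral_const_mul, hmean]
  simp only [Complex.ofReal_mul, Complex.ofReal_ofNat, Complex.exp_two_pi_mul_I, mul_one,
    Complex.ofReal_zero, zero_mul, Complex.exp_zero]
  push_cast
  ring

lemma enorm_T_le_lintegral_circle {f g : ℂ → ℂ} (hf : f ∈ analyticDisc) (hg : g ∈ analyticDisc)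
    {M : ℝ≥0} (hM : ∀ z : ℂ, ‖z‖ < 1 → ‖deriv g z‖ₑ ≤ M) {z : ℂ} (hz : ‖z‖ < 1) :
    ‖T g f z‖ₑ ≤ M * ∫⁻ θ in Set.Ioc (0 : ℝ) (2 * Real.pi),
      ‖f ((‖z‖ : ℂ) * Complex.exp (θ * Complex.I))‖ₑ := by
  have hmem : ∀ θ : ℝ, ‖z * Complex.exp (θ * Complex.I)‖ < 1 := fun θ => by
    rwa [norm_mul, Complex.norm_exp_ofReal_mul_I, mul_one]
  have h1 := two_pi_mul_eq_circle_integral (fun w hw => hasDerivAt_T hf hg hw)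
    (DifferentiableOn.mul hf (deriv_mem_analyticDisc hg)) T_apply_zero hz
  have hpi : (2 * Real.pi : ℂ) ≠ 0 := by exact_mod_cast Real.two_pi_pos.ne'
  have hpie : ‖(2 * Real.pi : ℂ)‖ₑ = ENNReal.ofReal (2 * Real.pi) := by
    rw [← ofReal_norm]
    congr 1
    rw [show (2 * Real.pi : ℂ) = ((2 * Real.pi : ℝ) : ℂ) by push_cast; rfl, Complex.norm_real,
      Real.norm_of_nonneg Real.two_pi_pos.le]
  have h2 : ENNReal.ofReal (2 * Real.pi) * ‖T g f z‖ₑ ≤ ENNReal.ofReal (2 * Real.pi) * (M *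
      ∫⁻ θ in Set.Ioc (0 : ℝ) (2 * Real.pi), ‖f (z * Complex.exp (θ * Complex.I))‖ₑ) := by
    rw [← hpie, ← enorm_mul, h1, enorm_neg, intervalIntegral.integral_of_le Real.two_pi_pos.le,
      hpie, ← mul_assoc, ← MeasureTheory.lintegral_const_mul' _ _
        (ENNReal.mul_ne_top ENNReal.ofReal_ne_top ENNReal.coe_ne_top)]
    refine (MeasureTheory.enorm_integral_le_lintegral_enorm _).trans
      (MeasureTheory.setLIntegral_mono_ae' measurableSet_Ioc (.of_forall fun θ hθ => ?_))
    have h3 : ‖((Real.pi - θ : ℝ) : ℂ)‖ₑ ≤ ENNReal.ofReal (2 * Real.pi) := by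
      rw [← ofReal_norm, Complex.norm_real, Real.norm_eq_abs]
      gcongr
      rw [abs_le]
      constructor <;> linarith [hθ.1, hθ.2]
    have h4 : ‖z * (Complex.exp (θ * Complex.I) * Complex.I)‖ₑ ≤ 1 := by
      rw [← mul_assoc, ← ofReal_norm, norm_mul, Complex.norm_I, mul_one]
      exact ENNReal.ofReal_le_one.2 (hmem θ).le
    calc _ = ‖((Real.pi - θ : ℝ) : ℂ)‖ₑ * (‖f (z * Complex.exp (θ * Complex.I))‖ₑ *
            ‖deriv g (z * Complex.exp (θ * Complex.I))‖ₑ *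
            ‖z * (Complex.exp (θ * Complex.I) * Complex.I)‖ₑ) := by
          rw [enorm_mul, enorm_mul, enorm_mul]
      _ ≤ ENNReal.ofReal (2 * Real.pi) * (‖f (z * Complex.exp (θ * Complex.I))‖ₑ * M * 1) := by
          gcongr
          exact hM _ (hmem θ)
      _ = _ := by ring
  rw [← lintegral_circle_rotate (fun w => ‖f w‖ₑ) z]
  exact (ENNReal.mul_le_mul_iff_right (by simpa using Real.pi_pos) ENNReal.ofReal_ne_top).1 h2

lemma enorm_T_le_integralMean {f g : ℂ → ℂ} (hf : f ∈ analyticDisc) (hg : g ∈ analyticDisc)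
    {M : ℝ≥0} (hM : ∀ z : ℂ, ‖z‖ < 1 → ‖deriv g z‖ₑ ≤ M) {z : ℂ} (hz : ‖z‖ < 1) :
    ‖T g f z‖ₑ ≤ M * (ENNReal.ofReal (2 * Real.pi) * integralMean 1 ‖z‖ f) := by
  rw [integralMean_one, ← mul_assoc (ENNReal.ofReal _), ← ENNReal.ofReal_mul Real.two_pi_pos.le,
    mul_one_div_cancel Real.two_pi_pos.ne', ENNReal.ofReal_one, one_mul]
  exact enorm_T_le_lintegral_circle hf hg hM hz

lemma isBoundedT_of_integralMean_le {N : (ℂ → ℂ) → ℝ≥0∞} {C : ℝ≥0}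
    (hN : ∀ f ∈ space N, ∀ r : ℝ, 0 < r → r < 1 → integralMean 1 r f ≤ C * N f)
    {g : ℂ → ℂ} (hg : g ∈ analyticDisc) {M : ℝ≥0} (hM : ∀ z : ℂ, ‖z‖ < 1 → ‖deriv g z‖ₑ ≤ M) :
    IsBoundedT N g := by
  refine isBoundedT_of_enorm_le hg (M * ((2 * Real.pi).toNNReal * C)) fun f hf z hz => ?_
  -- The means are controlled for positive radii only.
  rcases eq_or_ne z 0 with rfl | hz0
  · simp [T_apply_zero]
  · refine (enorm_T_le_integralMean hf.1 hg hM hz).trans ?_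
    push_cast
    rw [mul_assoc, mul_assoc]
    gcongr
    · rfl
    · exact hN f hf _ (norm_pos_iff.2 hz0) hz

lemma isBoundedT_hardy_one {g : ℂ → ℂ} (hg : g ∈ analyticDisc) {M : ℝ≥0}
    (hM : ∀ z : ℂ, ‖z‖ < 1 → ‖deriv g z‖ₑ ≤ M) : IsBoundedT (hardyNorm 1) g :=
  isBoundedT_of_integralMean_le (C := 1) (fun f _ r hr hr1 => by
    rw [ENNReal.coe_one, one_mul]
    exact le_iSup₂ (f := fun r (_ : r ∈ Set.Ioo (0 : ℝ) 1) => integralMean 1 r f) r ⟨hr, hr1⟩) hg hM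

end Hardy

/-! ### Polar coordinates on the disc. -/

section Polar

lemma continuous_polar :
    Continuous fun p : ℝ × ℝ => (p.1 : ℂ) * Complex.exp ((p.2 : ℂ) * Complex.I) := by
  fun_prop

/-- Integration over the unit disc in polar coordinates. -/
lemma lintegral_ball_polar {F : ℂ → ℝ≥0∞} (hF : Measurable F) :
    ∫⁻ z in Metric.ball (0 : ℂ) 1, F z = ∫⁻ r in Set.Ioo (0 : ℝ) 1, ENNReal.ofReal r *
      ∫⁻ θ in Set.Ioc (0 : ℝ) (2 * Real.pi), F ((r : ℂ) * Complex.exp ((θ : ℂ) * Complex.I)) := by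
  set G : ℝ × ℝ → ℝ≥0∞ := fun p =>
    ENNReal.ofReal p.1 * F ((p.1 : ℂ) * Complex.exp ((p.2 : ℂ) * Complex.I)) with hG
  have hGm : Measurable G := by
    have h1 := hF.comp continuous_polar.measurable
    have h2 : Measurable fun p : ℝ × ℝ => ENNReal.ofReal p.1 := by fun_prop
    exact h2.mul h1
  have hset : polarCoord.target ∩ {p : ℝ × ℝ | p.1 < 1} =
      Set.Ioo (0 : ℝ) 1 ×ˢ Set.Ioo (-Real.pi) Real.pi := by
    ext ⟨r, θ⟩
    simp [polarCoord]
    tauto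
  have hmeas : MeasurableSet {p : ℝ × ℝ | p.1 < 1} := measurableSet_lt measurable_fst measurable_const
  rw [← MeasureTheory.lintegral_indicator Metric.isOpen_ball.measurableSet,
    ← Complex.lintegral_comp_polarCoord_symm]
  have h1 : ∀ p ∈ polarCoord.target, ENNReal.ofReal p.1 •
      (Metric.ball (0 : ℂ) 1).indicator F (Complex.polarCoord.symm p) =
      {p : ℝ × ℝ | p.1 < 1}.indicator G p := by
    intro p hp
    have hp0 : 0 < p.1 := hp.1
    have hs : (Complex.polarCoord.symm p : ℂ) = (p.1 : ℂ) * Complex.exp ((p.2 : ℂ) * Complex.I) := by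
      rw [Complex.polarCoord_symm_apply, Complex.exp_mul_I]
      push_cast
      rfl
    have hn : ‖(p.1 : ℂ) * Complex.exp ((p.2 : ℂ) * Complex.I)‖ = p.1 := by
      rw [norm_mul, Complex.norm_exp_ofReal_mul_I, mul_one, Complex.norm_real,
        Real.norm_of_nonneg hp0.le]
    rw [hs, smul_eq_mul]
    by_cases h : p.1 < 1
    · rw [Set.indicator_of_mem (by rwa [mem_ball_zero_iff, hn]),
        Set.indicator_of_mem (s := {p : ℝ × ℝ | p.1 < 1}) h]
    · rw [Set.indicator_of_notMem (by rw [mem_ball_zero_iff, hn]; exact h),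
        Set.indicator_of_notMem (s := {p : ℝ × ℝ | p.1 < 1}) h, mul_zero]
  rw [MeasureTheory.setLIntegral_congr_fun polarCoord.open_target.measurableSet h1,
    MeasureTheory.setLIntegral_indicator hmeas, Set.inter_comm, hset,
    MeasureTheory.Measure.volume_eq_prod, ← MeasureTheory.Measure.prod_restrict,
    MeasureTheory.lintegral_prod _ hGm.aemeasurable]
  refine MeasureTheory.lintegral_congr fun r => ?_
  simp only [hG]
  rw [MeasureTheory.lintegral_const_mul' _ _ ENNReal.ofReal_ne_top,
    MeasureTheory.restrict_Ioo_eq_restrict_Ioc]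
  congr 1
  have h2 := lintegral_Ioc_add_period Real.two_pi_pos (periodic_exp_mul_I F r) (-Real.pi) 0
  rwa [zero_add, show -Real.pi + 2 * Real.pi = Real.pi by ring] at h2

end Polar

/-! ### Sufficiency for `D^1_0`, by embedding it in `H^1`. -/

section Dirichlet

variable {f : ℂ → ℂ}

/-- The integral of `‖h‖` over the circle of radius `r`, with respect to the angle. -/
noncomputable def circleMass (h : ℂ → ℂ) (r : ℝ) : ℝ≥0∞ :=
  ∫⁻ θ in Set.Ioc (0 : ℝ) (2 * Real.pi), ‖h ((r : ℂ) * Complex.exp ((θ : ℂ) * Complex.I))‖ₑ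

/-- The integral of `‖h‖` over the unit disc, in polar coordinates. -/
noncomputable def discMass (h : ℂ → ℂ) : ℝ≥0∞ :=
  ∫⁻ r in Set.Ioo (0 : ℝ) 1, ENNReal.ofReal r * circleMass h r

/-- Cauchy's formula on the circle of radius `s`, whose points are at distance at least `1/4` from
`w`; the gain `1 / (2π)` is dropped. -/
lemma enorm_le_circleMass {h : ℂ → ℂ} (hh : h ∈ analyticDisc) {w : ℂ} (hw : ‖w‖ ≤ 1 / 2) {s : ℝ}
    (hs : s ∈ Set.Ioo (3 / 4 : ℝ) 1) :
    ‖h w‖ₑ ≤ 4 * (ENNReal.ofReal s * circleMass h s) := by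
  have hs0 : 0 < s := by linarith [hs.1]
  have hd : DiffContOnCl ℂ h (Metric.ball 0 s) := by
    refine DifferentiableOn.diffContOnCl fun z hz => ?_
    rw [closure_ball _ hs0.ne', mem_closedBall_zero_iff] at hz
    exact (differentiableAt_of_mem_analyticDisc hh (hz.trans_lt hs.2)).differentiableWithinAt
  have hc := hd.circleIntegral_sub_inv_smul (w := w) (by
    rw [mem_ball_zero_iff]; linarith [hs.1])
  have h1 : (1 : ℝ≥0∞) ≤ ‖(2 * Real.pi * Complex.I : ℂ)‖ₑ := by
    rw [← ofReal_norm, ENNReal.one_le_ofReal]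
    simp only [norm_mul, Complex.norm_I, mul_one, Complex.norm_real, Complex.norm_ofNat,
      Real.norm_of_nonneg Real.pi_pos.le]
    linarith [Real.pi_gt_three]
  calc ‖h w‖ₑ ≤ ‖(2 * Real.pi * Complex.I : ℂ)‖ₑ * ‖h w‖ₑ := le_mul_of_one_le_left bot_le h1
    _ = ‖∮ z in C(0, s), (z - w)⁻¹ • h z‖ₑ := by rw [hc, enorm_smul]
    _ ≤ ∫⁻ θ in Set.Ioc (0 : ℝ) (2 * Real.pi),
        ‖deriv (circleMap 0 s) θ • ((circleMap 0 s θ - w)⁻¹ • h (circleMap 0 s θ))‖ₑ := by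
      rw [circleIntegral, intervalIntegral.integral_of_le Real.two_pi_pos.le]
      exact MeasureTheory.enorm_integral_le_lintegral_enorm _
    _ ≤ ∫⁻ θ in Set.Ioc (0 : ℝ) (2 * Real.pi), (4 * ENNReal.ofReal s) *
        ‖h ((s : ℂ) * Complex.exp ((θ : ℂ) * Complex.I))‖ₑ := by
      refine MeasureTheory.setLIntegral_mono_ae' measurableSet_Ioc (.of_forall fun θ _ => ?_)
      rw [smul_smul, enorm_smul, show circleMap 0 s θ = (s : ℂ) * Complex.exp (θ * Complex.I) by
        simp [circleMap]]
      gcongr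
      have hn : ‖(s : ℂ) * Complex.exp (θ * Complex.I)‖ = s := by
        rw [norm_mul, Complex.norm_exp_ofReal_mul_I, mul_one, Complex.norm_real,
          Real.norm_of_nonneg hs0.le]
      have h2 : 1 / 4 ≤ ‖(s : ℂ) * Complex.exp (θ * Complex.I) - w‖ := by
        have := norm_sub_norm_le ((s : ℂ) * Complex.exp (θ * Complex.I)) w
        rw [hn] at this
        linarith [hs.1]
      rw [← ofReal_norm, show (4 : ℝ≥0∞) = ENNReal.ofReal 4 by simp,
        ← ENNReal.ofReal_mul (by norm_num), norm_mul, deriv_circleMap, norm_mul, Complex.norm_I,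
        mul_one, norm_inv, show circleMap 0 s θ = (s : ℂ) * Complex.exp (θ * Complex.I) by
        simp [circleMap], hn]
      refine ENNReal.ofReal_le_ofReal ?_
      rw [mul_comm]
      gcongr
      rw [inv_le_comm₀ (by linarith) (by norm_num)]
      linarith
    _ = _ := by
      rw [MeasureTheory.lintegral_const_mul' _ _
        (ENNReal.mul_ne_top (by simp) ENNReal.ofReal_ne_top), circleMass, mul_assoc]

/-- The circle estimate is averaged over `s` in `(3/4, 1)`, an interval of length `1/4`, whence `16
= 4 * 4`. -/
lemma enorm_le_discMass {h : ℂ → ℂ} (hh : h ∈ analyticDisc) {w : ℂ} (hw : ‖w‖ ≤ 1 / 2) :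
    ‖h w‖ₑ ≤ 16 * discMass h := by
  have h1 : ∫⁻ _ in Set.Ioo (3 / 4 : ℝ) 1, ‖h w‖ₑ ≤ 4 * discMass h := by
    rw [discMass, ← MeasureTheory.lintegral_const_mul' _ _ (by simp)]
    refine (MeasureTheory.setLIntegral_mono_ae' measurableSet_Ioo
      (.of_forall fun s hs => enorm_le_circleMass hh hw hs)).trans ?_
    exact MeasureTheory.lintegral_mono_set (Set.Ioo_subset_Ioo_left (by norm_num))
  rw [MeasureTheory.setLIntegral_const, Real.volume_Ioo] at h1
  have h2 : (4 : ℝ≥0∞) * ENNReal.ofReal (1 - 3 / 4) = 1 := by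
    rw [show (4 : ℝ≥0∞) = ENNReal.ofReal 4 by simp, ← ENNReal.ofReal_mul (by norm_num)]
    norm_num
  calc ‖h w‖ₑ = 4 * (‖h w‖ₑ * ENNReal.ofReal (1 - 3 / 4)) := by
        rw [mul_comm ‖h w‖ₑ, ← mul_assoc, h2, one_mul]
    _ ≤ 4 * (4 * discMass h) := by gcongr
    _ = 16 * discMass h := by rw [← mul_assoc]; norm_num

/-- This removes the polar Jacobian `r`: for `r ≥ 1/2` it costs a factor 2, and for `r ≤ 1/2` the
interior estimate `enorm_le_discMass` bounds the integrand uniformly. -/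
lemma lintegral_circleMass_le {h : ℂ → ℂ} (hh : h ∈ analyticDisc) :
    ∫⁻ r in Set.Ioo (0 : ℝ) 1, circleMass h r ≤
      (16 * ENNReal.ofReal (2 * Real.pi) + 2) * discMass h := by
  have h1 : ∀ r ∈ Set.Ioo (0 : ℝ) 1, circleMass h r ≤
      16 * ENNReal.ofReal (2 * Real.pi) * discMass h + 2 * (ENNReal.ofReal r * circleMass h r) := by
    intro r hr
    rcases le_total r (1 / 2) with hr' | hr'
    · refine le_add_of_le_of_nonneg ?_ bot_le
      refine (MeasureTheory.setLIntegral_mono_ae' measurableSet_Ioc (.of_forall fun (θ : ℝ) _ =>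
        enorm_le_discMass hh (w := (r : ℂ) * Complex.exp ((θ : ℂ) * Complex.I)) ?_)).trans ?_
      · rwa [norm_mul, Complex.norm_exp_ofReal_mul_I, mul_one, Complex.norm_real,
          Real.norm_of_nonneg hr.1.le]
      · rw [MeasureTheory.setLIntegral_const, Real.volume_Ioc, sub_zero]
        exact le_of_eq (by ring)
    · refine le_add_of_nonneg_of_le bot_le ?_
      rw [← mul_assoc]
      refine le_mul_of_one_le_left bot_le ?_
      rw [show (2 : ℝ≥0∞) = ENNReal.ofReal 2 by simp, ← ENNReal.ofReal_mul (by norm_num),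
        ENNReal.one_le_ofReal]
      linarith
  refine (MeasureTheory.setLIntegral_mono_ae' measurableSet_Ioo (.of_forall h1)).trans ?_
  rw [MeasureTheory.lintegral_add_left measurable_const, MeasureTheory.setLIntegral_const,
    Real.volume_Ioo, MeasureTheory.lintegral_const_mul' _ _ (by simp), sub_zero,
    ENNReal.ofReal_one, mul_one, ← discMass, add_mul]

lemma enorm_le_add_lintegral_deriv (hf : f ∈ analyticDisc) {r : ℝ} (hr : 0 < r) (hr1 : r < 1)
    (θ : ℝ) : ‖f ((r : ℂ) * Complex.exp (θ * Complex.I))‖ₑ ≤ ‖f 0‖ₑ +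
      ∫⁻ t in Set.Ioo (0 : ℝ) 1, ‖deriv f ((t : ℂ) * Complex.exp (θ * Complex.I))‖ₑ := by
  set ζ := Complex.exp (θ * Complex.I)
  have hζ : ‖ζ‖ = 1 := Complex.norm_exp_ofReal_mul_I θ
  have hmem : ∀ t ∈ Set.uIcc (0 : ℝ) r, ‖(t : ℂ) * ζ‖ < 1 := by
    intro t ht
    rw [Set.uIcc_of_le hr.le] at ht
    rw [norm_mul, hζ, mul_one, Complex.norm_real, Real.norm_of_nonneg ht.1]
    exact ht.2.trans_lt hr1
  have h1 : ∀ t ∈ Set.uIcc (0 : ℝ) r, HasDerivAt (fun t : ℝ => f ((t : ℂ) * ζ))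
      (deriv f ((t : ℂ) * ζ) * ζ) t := by
    intro t ht
    have h2 : HasDerivAt (fun t : ℝ => (t : ℂ) * ζ) ζ t := by
      simpa using (Complex.ofRealCLM.hasDerivAt (x := t)).mul_const ζ
    exact HasDerivAt.comp t (h := fun t : ℝ => (t : ℂ) * ζ)
      (differentiableAt_of_mem_analyticDisc hf (hmem t ht)).hasDerivAt h2
  have hcont : ContinuousOn (fun t : ℝ => deriv f ((t : ℂ) * ζ) * ζ) (Set.uIcc 0 r) :=
    ((DifferentiableOn.continuousOn (deriv_mem_analyticDisc hf)).comp (by fun_prop)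
      fun t ht => by simpa using hmem t ht).mul continuousOn_const
  have h3 := intervalIntegral.integral_eq_sub_of_hasDerivAt h1 hcont.intervalIntegrable
  rw [Complex.ofReal_zero, zero_mul, eq_sub_iff_add_eq'] at h3
  rw [← h3]
  refine (enorm_add_le _ _).trans ?_
  gcongr
  rw [intervalIntegral.integral_of_le hr.le]
  refine (MeasureTheory.enorm_integral_le_lintegral_enorm _).trans ?_
  refine (MeasureTheory.lintegral_mono_set (t := Set.Ioo (0 : ℝ) 1) fun t ht =>
    ⟨ht.1, ht.2.trans_lt hr1⟩).trans (le_of_eq (MeasureTheory.lintegral_congr fun t => ?_))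
  rw [enorm_mul, ← ofReal_norm ζ, hζ, ENNReal.ofReal_one, mul_one]

lemma dirichletNorm_one (f : ℂ → ℂ) : dirichletNorm 1 f =
    ENNReal.ofReal (1 / Real.pi) * discMass (deriv f) + ‖f 0‖ₑ := by
  simp only [dirichletNorm, div_one, ENNReal.rpow_one, sub_self, Real.rpow_zero,
    ENNReal.ofReal_one, mul_one]
  rw [lintegral_ball_polar (by fun_prop)]
  rfl

lemma integralMean_one_le (hf : f ∈ analyticDisc) {r : ℝ} (hr : 0 < r) (hr1 : r < 1) :
    integralMean 1 r f ≤ ‖f 0‖ₑ + ∫⁻ t in Set.Ioo (0 : ℝ) 1, circleMass (deriv f) t := by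
  have hm : Measurable fun p : ℝ × ℝ =>
      ‖deriv f ((p.2 : ℂ) * Complex.exp ((p.1 : ℂ) * Complex.I))‖ₑ :=
    Measurable.enorm ((measurable_deriv f).comp
      (f := fun p : ℝ × ℝ => (p.2 : ℂ) * Complex.exp ((p.1 : ℂ) * Complex.I))
      (Continuous.measurable (by fun_prop)))
  have h1 : ∫⁻ θ in Set.Ioc (0 : ℝ) (2 * Real.pi), ‖f ((r : ℂ) * Complex.exp (θ * Complex.I))‖ₑ ≤
      ENNReal.ofReal (2 * Real.pi) * ‖f 0‖ₑ +
        ∫⁻ t in Set.Ioo (0 : ℝ) 1, circleMass (deriv f) t := by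
    refine (MeasureTheory.setLIntegral_mono_ae' measurableSet_Ioc (.of_forall fun θ _ =>
      enorm_le_add_lintegral_deriv hf hr hr1 θ)).trans ?_
    rw [MeasureTheory.lintegral_add_left measurable_const, MeasureTheory.setLIntegral_const,
      Real.volume_Ioc, sub_zero, mul_comm, MeasureTheory.lintegral_lintegral_swap hm.aemeasurable]
    rfl
  rw [integralMean_one]
  calc _ ≤ ENNReal.ofReal (1 / (2 * Real.pi)) * (ENNReal.ofReal (2 * Real.pi) * ‖f 0‖ₑ +
        ∫⁻ t in Set.Ioo (0 : ℝ) 1, circleMass (deriv f) t) := by gcongr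
    _ = ‖f 0‖ₑ + ENNReal.ofReal (1 / (2 * Real.pi)) *
        ∫⁻ t in Set.Ioo (0 : ℝ) 1, circleMass (deriv f) t := by
      rw [mul_add, ← mul_assoc, ← ENNReal.ofReal_mul (by positivity),
        one_div_mul_cancel Real.two_pi_pos.ne', ENNReal.ofReal_one, one_mul]
    _ ≤ _ := by
      gcongr
      refine mul_le_of_le_one_left bot_le (ENNReal.ofReal_le_one.2 ?_)
      rw [div_le_one Real.two_pi_pos]
      linarith [Real.pi_gt_three]

lemma isBoundedT_dirichlet_one {g : ℂ → ℂ} (hg : g ∈ analyticDisc) {M : ℝ≥0}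
    (hM : ∀ z : ℂ, ‖z‖ < 1 → ‖deriv g z‖ₑ ≤ M) : IsBoundedT (dirichletNorm 1) g := by
  refine isBoundedT_of_integralMean_le
    (C := 1 + (16 * (2 * Real.pi).toNNReal + 2) * Real.pi.toNNReal) (fun f hf r hr hr1 => ?_) hg hM
  have hA : discMass (deriv f) ≤ ENNReal.ofReal Real.pi * dirichletNorm 1 f := by
    rw [dirichletNorm_one, mul_add, ← mul_assoc, ← ENNReal.ofReal_mul Real.pi_pos.le,
      mul_one_div_cancel Real.pi_ne_zero, ENNReal.ofReal_one, one_mul]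
    exact le_self_add
  have h0 : ‖f 0‖ₑ ≤ dirichletNorm 1 f := by
    rw [dirichletNorm_one]
    exact le_add_self
  refine (integralMean_one_le hf.1 hr hr1).trans ?_
  push_cast
  rw [add_mul, one_mul]
  refine add_le_add h0 ((lintegral_circleMass_le (deriv_mem_analyticDisc hf.1)).trans ?_)
  rw [mul_assoc]
  exact mul_le_mul_right hA _

end Dirichlet

/-! ### Monomials as test functions for `HL_p`. -/

section HardyLittlewoodTest

lemma maclaurin_const_mul_pow (a : ℂ) (n k : ℕ) :
    maclaurin (fun z => a * z ^ n) k = if k = n then a else 0 := by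
  rw [maclaurin, iteratedDeriv_const_mul_field, iteratedDeriv_fun_pow_zero]
  by_cases h : k = n
  · subst h
    have : (k.factorial : ℂ) ≠ 0 := by exact_mod_cast k.factorial_ne_zero
    simp [this]
  · simp [h]

lemma hardyLittlewoodNorm_const_mul_pow {p : ℝ} (hp : 0 < p) (a : ℂ) (n : ℕ) :
    hardyLittlewoodNorm p (fun z => a * z ^ n) =
      ENNReal.ofReal ((‖a‖ ^ p * ((n : ℝ) + 1) ^ (p - 2)) ^ (1 / p)) := by
  rw [hardyLittlewoodNorm, tsum_eq_single n]
  · rw [maclaurin_const_mul_pow, if_pos rfl, ← ofReal_norm,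
      ENNReal.ofReal_rpow_of_nonneg (norm_nonneg a) hp.le, ← ENNReal.ofReal_mul (by positivity),
      ENNReal.ofReal_rpow_of_nonneg (by positivity) (by positivity)]
  · intro k hk
    rw [maclaurin_const_mul_pow, if_neg hk, enorm_zero, ENNReal.zero_rpow_of_pos hp, zero_mul]

/-- Since `testRadius n = (1 + 1/(n+1))⁻¹`, the inequality `1 + x ≤ exp x` bounds it below by `exp
(-1/(n+1))`. -/
lemma exp_neg_one_le_testRadius_pow (n : ℕ) : Real.exp (-1) ≤ testRadius n ^ n := by
  have hn : (0 : ℝ) < (n : ℝ) + 1 := by positivity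
  have h1 : Real.exp (-(1 / ((n : ℝ) + 1))) ≤ testRadius n := by
    have h2 := Real.add_one_le_exp (1 / ((n : ℝ) + 1))
    rw [Real.exp_neg]
    refine (inv_anti₀ (by positivity) h2).trans (le_of_eq ?_)
    rw [testRadius]
    have : (n : ℝ) + 2 ≠ 0 := by positivity
    field_simp
    ring
  calc Real.exp (-1) ≤ Real.exp (n * -(1 / ((n : ℝ) + 1))) := by
        gcongr
        rw [mul_neg, neg_le_neg_iff, mul_one_div, div_le_one hn]
        linarith
    _ = Real.exp (-(1 / ((n : ℝ) + 1))) ^ n := Real.exp_nat_mul _ n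
    _ ≤ testRadius n ^ n := by gcongr

lemma tendsto_rpow_mul_pow (s : ℝ) {R : ℝ} (hR : 0 < R) (hR1 : R < 1) :
    Filter.Tendsto (fun n : ℕ => ((n : ℝ) + 2) ^ s * R ^ n) Filter.atTop (nhds 0) := by
  obtain ⟨k, hk⟩ := exists_nat_ge s
  have h1 : Filter.Tendsto (fun n : ℕ => ((n + 2 : ℕ) : ℝ) ^ k * R ^ (n + 2) / R ^ 2) Filter.atTop
      (nhds (0 / R ^ 2)) :=
    ((tendsto_pow_const_mul_const_pow_of_abs_lt_one k (by rwa [abs_of_pos hR])).comp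
      (Filter.tendsto_add_atTop_nat 2)).div_const _
  rw [zero_div] at h1
  refine squeeze_zero (fun n => by positivity) (fun n => ?_) h1
  rw [pow_add, ← mul_assoc, mul_div_cancel_right₀ _ (by positivity)]
  gcongr
  rw [← Real.rpow_natCast]
  push_cast
  exact Real.rpow_le_rpow_of_exponent_le (by linarith [Nat.cast_nonneg (α := ℝ) n]) hk

lemma isTestFamily_hardyLittlewood {p : ℝ} (hp : 0 < p) (hp1 : p ≤ 1) :
    IsTestFamily (hardyLittlewoodNorm p) (fun n => Real.exp (-1) * ((n : ℝ) + 2) ^ (1 / p - 1))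
      (((2 : ℝ) ^ (2 - p)) ^ (1 / p)).toNNReal
      (fun n _ z => (((n : ℝ) + 2) ^ (2 / p - 1) : ℝ) * z ^ n) where
  analytic n ζ _ := by
    refine Differentiable.differentiableOn ?_
    fun_prop
  norm_le n ζ _ := by
    have hn : (0 : ℝ) < (n : ℝ) + 1 := by positivity
    rw [hardyLittlewoodNorm_const_mul_pow hp]
    change _ ≤ ENNReal.ofReal _
    gcongr
    rw [Complex.norm_real, Real.norm_of_nonneg (by positivity), ← Real.rpow_mul (by positivity),
      show (2 / p - 1) * p = 2 - p by field_simp, show p - 2 = -(2 - p) by ring,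
      Real.rpow_neg hn.le, ← div_eq_mul_inv, ← Real.div_rpow (by positivity) hn.le]
    gcongr
    · linarith
    · rw [div_le_iff₀ hn]
      linarith [Nat.cast_nonneg (α := ℝ) n]
  le_apply n ζ hζ := by
    have hn : (0 : ℝ) < (n : ℝ) + 2 := by positivity
    rw [norm_mul, norm_pow, norm_testRadius_mul n hζ, Complex.norm_real,
      Real.norm_of_nonneg (by positivity), testRadius, sub_sub_cancel, ← testRadius]
    calc Real.exp (-1) * ((n : ℝ) + 2) ^ (1 / p - 1)
        ≤ testRadius n ^ n * ((n : ℝ) + 2) ^ (2 / p - 1 - 1) := by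
          refine mul_le_mul (exp_neg_one_le_testRadius_pow n) ?_ (by positivity)
            (pow_nonneg (testRadius_pos n).le n)
          · refine Real.rpow_le_rpow_of_exponent_le (by linarith [Nat.cast_nonneg (α := ℝ) n]) ?_
            have : 1 ≤ 1 / p := by rwa [le_div_iff₀ hp, one_mul]
            have : 2 / p = 2 * (1 / p) := by ring
            linarith
      _ = _ := by
          rw [Real.rpow_sub_one hn.ne']
          ring
  vanish R hR hR1 := by
    refine ⟨_, tendsto_rpow_mul_pow (2 / p - 1) hR hR1, fun n ζ w _ hw => ?_⟩
    rw [norm_mul, norm_pow, Complex.norm_real, Real.norm_of_nonneg (by positivity)]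
    gcongr

end HardyLittlewoodTest

/-! ### Integral estimates for powers of the Cauchy kernel. -/

section KernelIntegrals

lemma one_sub_norm_le_norm_one_sub {w : ℂ} (θ : ℝ) :
    1 - ‖w‖ ≤ ‖1 - w * Complex.exp (θ * Complex.I)‖ := by
  have := norm_sub_norm_le (1 : ℂ) (w * Complex.exp (θ * Complex.I))
  rwa [norm_one, norm_mul, Complex.norm_exp_ofReal_mul_I, mul_one] at this

/-- The real part of `(1 + wu)/(1 - wu)` on `|u| = 1` is the Poisson kernel, and the mean value
property gives it average 1. -/
lemma integral_inv_norm_one_sub_sq {w : ℂ} (hw : ‖w‖ < 1) :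
    ∫ θ in (0 : ℝ)..2 * Real.pi, (‖1 - w * Complex.exp (θ * Complex.I)‖ ^ 2)⁻¹ =
      2 * Real.pi / (1 - ‖w‖ ^ 2) := by
  have hne : ∀ u : ℂ, ‖u‖ ≤ 1 → 1 - w * u ≠ 0 := by
    intro u hu h
    have h1 : ‖w * u‖ = 1 := by rw [← sub_eq_zero.1 h, norm_one]
    rw [norm_mul] at h1
    nlinarith [norm_nonneg w, norm_nonneg u]
  have hd : DiffContOnCl ℂ (fun u => (1 + w * u) / (1 - w * u)) (Metric.ball 0 |1|) := by
    refine DifferentiableOn.diffContOnCl fun u hu => ?_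
    rw [abs_one, closure_ball _ one_ne_zero, mem_closedBall_zero_iff] at hu
    exact (DifferentiableAt.div (c := fun u => 1 + w * u) (d := fun u => 1 - w * u)
      (by fun_prop) (by fun_prop) (hne u hu)).differentiableWithinAt
  have h1 := hd.circleAverage
  have hpos : 0 < 1 - ‖w‖ ^ 2 := by nlinarith [norm_nonneg w]
  have hre : ∀ θ : ℝ, (((1 + w * Complex.exp (θ * Complex.I)) /
      (1 - w * Complex.exp (θ * Complex.I))).re : ℝ) =
      (1 - ‖w‖ ^ 2) * (‖1 - w * Complex.exp (θ * Complex.I)‖ ^ 2)⁻¹ := by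
    intro θ
    set v := w * Complex.exp (θ * Complex.I) with hv
    have hvw : ‖w‖ = ‖v‖ := by rw [hv, norm_mul, Complex.norm_exp_ofReal_mul_I, mul_one]
    rw [hvw, Complex.div_re, ← Complex.normSq_eq_norm_sq, ← Complex.normSq_eq_norm_sq,
      Complex.normSq_apply v]
    simp only [Complex.add_re, Complex.sub_re, Complex.add_im, Complex.sub_im, Complex.one_re,
      Complex.one_im]
    ring
  have hcont : Continuous fun θ : ℝ => (1 + w * Complex.exp (θ * Complex.I)) /
      (1 - w * Complex.exp (θ * Complex.I)) :=
    Continuous.div (by fun_prop) (by fun_prop) fun θ =>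
      hne _ (Complex.norm_exp_ofReal_mul_I θ).le
  rw [Real.circleAverage, mul_zero, add_zero, sub_zero, div_one] at h1
  simp only [circleMap, Complex.ofReal_one, one_mul, zero_add] at h1
  have h2 : ∫ θ in (0 : ℝ)..2 * Real.pi, (1 + w * Complex.exp (θ * Complex.I)) /
      (1 - w * Complex.exp (θ * Complex.I)) = ((2 * Real.pi : ℝ) : ℂ) := by
    rw [inv_smul_eq_iff₀ Real.two_pi_pos.ne'] at h1
    rw [h1]
    simp
  have h3 := Complex.reCLM.intervalIntegral_comp_comm (hcont.intervalIntegrable 0 (2 * Real.pi)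
    (μ := MeasureTheory.volume))
  simp only [Complex.reCLM_apply, hre] at h3
  rw [h2, intervalIntegral.integral_const_mul, Complex.ofReal_re] at h3
  rw [eq_div_iff hpos.ne', mul_comm]
  exact h3

lemma lintegral_inv_norm_one_sub_sq_le {w : ℂ} (hw : ‖w‖ < 1) :
    ∫⁻ θ in Set.Ioc (0 : ℝ) (2 * Real.pi),
      ENNReal.ofReal ((‖1 - w * Complex.exp (θ * Complex.I)‖ ^ 2)⁻¹) ≤
      ENNReal.ofReal (2 * Real.pi * (1 - ‖w‖)⁻¹) := by
  have hpos : 0 < 1 - ‖w‖ := by linarith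
  have hcont : Continuous fun θ : ℝ => (‖1 - w * Complex.exp (θ * Complex.I)‖ ^ 2)⁻¹ :=
    Continuous.inv₀ (by fun_prop) fun θ =>
      pow_ne_zero 2 (hpos.trans_le (one_sub_norm_le_norm_one_sub θ)).ne'
  rw [← MeasureTheory.ofReal_integral_eq_lintegral_ofReal
    (hcont.intervalIntegrable 0 (2 * Real.pi)).1 (.of_forall fun θ => by positivity),
    ← intervalIntegral.integral_of_le Real.two_pi_pos.le, integral_inv_norm_one_sub_sq hw,
    div_eq_mul_inv]
  gcongr
  nlinarith [norm_nonneg w]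

/-- Two of the `q` powers are integrated by the Poisson identity; the other `q - 2` are estimated by
`‖1 - w e^{iθ}‖ ≥ 1 - ‖w‖`. -/
lemma lintegral_norm_one_sub_rpow_le {w : ℂ} (hw : ‖w‖ < 1) {q : ℝ} (hq : 2 ≤ q) :
    ∫⁻ θ in Set.Ioc (0 : ℝ) (2 * Real.pi),
      ENNReal.ofReal (‖1 - w * Complex.exp (θ * Complex.I)‖ ^ (-q)) ≤
      ENNReal.ofReal (2 * Real.pi * (1 - ‖w‖) ^ (1 - q)) := by
  have hpos : 0 < 1 - ‖w‖ := by linarith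
  calc _ ≤ ∫⁻ θ in Set.Ioc (0 : ℝ) (2 * Real.pi), ENNReal.ofReal ((1 - ‖w‖) ^ (2 - q)) *
        ENNReal.ofReal ((‖1 - w * Complex.exp (θ * Complex.I)‖ ^ 2)⁻¹) := by
        refine MeasureTheory.lintegral_mono fun θ => ?_
        have h1 := one_sub_norm_le_norm_one_sub (w := w) θ
        have hx := hpos.trans_le h1
        rw [← ENNReal.ofReal_mul (by positivity), show -q = (2 - q) + -(2 : ℕ) by push_cast; ring,
          Real.rpow_add hx, Real.rpow_neg hx.le, Real.rpow_natCast]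
        refine ENNReal.ofReal_le_ofReal (mul_le_mul_of_nonneg_right ?_ (by positivity))
        exact Real.rpow_le_rpow_of_nonpos hpos h1 (by linarith)
    _ ≤ ENNReal.ofReal ((1 - ‖w‖) ^ (2 - q)) * ENNReal.ofReal (2 * Real.pi * (1 - ‖w‖)⁻¹) := by
        rw [MeasureTheory.lintegral_const_mul' _ _ ENNReal.ofReal_ne_top]
        gcongr
        exact lintegral_inv_norm_one_sub_sq_le hw
    _ = _ := by
        rw [← ENNReal.ofReal_mul (by positivity), show 1 - q = (2 - q) - 1 by ring,
          Real.rpow_sub_one hpos.ne']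
        congr 1
        ring

lemma lintegral_Ioo_one_sub (F : ℝ → ℝ≥0∞) :
    ∫⁻ r in Set.Ioo (0 : ℝ) 1, F (1 - r) = ∫⁻ s in Set.Ioo (0 : ℝ) 1, F s := by
  have h := (MeasureTheory.Measure.measurePreserving_sub_left
    (MeasureTheory.volume : MeasureTheory.Measure ℝ) 1).setLIntegral_comp_preimage_emb
    (MeasurableEquiv.subLeft (1 : ℝ)).measurableEmbedding F (Set.Ioo 0 1)
  rwa [show (fun r : ℝ => 1 - r) ⁻¹' Set.Ioo 0 1 = Set.Ioo 0 1 by ext; simp] at h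

lemma lintegral_Ioc_rpow {a δ : ℝ} (ha : 0 < a) (hδ : 0 < δ) :
    ∫⁻ s in Set.Ioc (0 : ℝ) δ, ENNReal.ofReal (s ^ (a - 1)) = ENNReal.ofReal (δ ^ a / a) := by
  rw [← MeasureTheory.ofReal_integral_eq_lintegral_ofReal]
  · rw [← intervalIntegral.integral_of_le hδ.le, integral_rpow (Or.inl (by linarith)),
      sub_add_cancel, Real.zero_rpow ha.ne', sub_zero]
  · exact (intervalIntegral.intervalIntegrable_rpow' (by linarith)).1
  · filter_upwards [MeasureTheory.ae_restrict_mem measurableSet_Ioc] with s hs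
    exact Real.rpow_nonneg hs.1.le _

lemma lintegral_Ioi_rpow {b δ : ℝ} (hb : 0 < b) (hδ : 0 < δ) :
    ∫⁻ s in Set.Ioi δ, ENNReal.ofReal (s ^ (-b - 1)) = ENNReal.ofReal (δ ^ (-b) / b) := by
  rw [← MeasureTheory.ofReal_integral_eq_lintegral_ofReal]
  · rw [integral_Ioi_rpow_of_lt (by linarith) hδ, sub_add_cancel, neg_div_neg_eq]
  · exact integrableOn_Ioi_rpow_of_lt (by linarith) hδ
  · filter_upwards [MeasureTheory.ae_restrict_mem measurableSet_Ioi] with s hs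
    exact Real.rpow_nonneg (hδ.trans hs).le _

/-- With `s = 1 - r` the base is `s + δ - δs`, at least both `s` and `δ`. Using `δ` for `s ≤ δ`
yields `1/p`, and using `s` for `s > δ` yields `1/(q - p)`. -/
lemma lintegral_weight_mul_rpow_le {p q δ : ℝ} (hp : 0 < p) (hq : p < q) (hδ : 0 < δ)
    (hδ1 : δ < 1) :
    ∫⁻ r in Set.Ioo (0 : ℝ) 1,
      ENNReal.ofReal ((1 - r) ^ (p - 1) * (1 - (1 - δ) * r) ^ (-q)) ≤
      ENNReal.ofReal ((1 / p + 1 / (q - p)) * δ ^ (p - q)) := by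
  have hrefl := lintegral_Ioo_one_sub fun s =>
    ENNReal.ofReal (s ^ (p - 1) * (1 - (1 - δ) * (1 - s)) ^ (-q))
  simp only [sub_sub_cancel] at hrefl
  rw [hrefl]
  have hsub : Set.Ioo (0 : ℝ) 1 ⊆ (Set.Ioo 0 1 ∩ Set.Ioc 0 δ) ∪ (Set.Ioo 0 1 ∩ Set.Ioi δ) := by
    intro s hs
    rcases le_or_gt s δ with h | h
    · exact Or.inl ⟨hs, hs.1, h⟩
    · exact Or.inr ⟨hs, h⟩
  refine (MeasureTheory.lintegral_mono_set hsub).trans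
    ((MeasureTheory.lintegral_union_le _ _ _).trans ?_)
  have hδq : 0 ≤ δ ^ (-q) := by positivity
  have h1 : ∫⁻ s in Set.Ioo (0 : ℝ) 1 ∩ Set.Ioc 0 δ,
      ENNReal.ofReal (s ^ (p - 1) * (1 - (1 - δ) * (1 - s)) ^ (-q)) ≤
      ENNReal.ofReal (1 / p * δ ^ (p - q)) := by
    calc _ ≤ ∫⁻ s in Set.Ioo (0 : ℝ) 1 ∩ Set.Ioc 0 δ,
          ENNReal.ofReal (δ ^ (-q)) * ENNReal.ofReal (s ^ (p - 1)) := by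
          refine MeasureTheory.setLIntegral_mono_ae' (measurableSet_Ioo.inter measurableSet_Ioc)
            (.of_forall fun s hs => ?_)
          have hs0 := hs.1.1
          have hs1 := hs.1.2
          rw [← ENNReal.ofReal_mul hδq, mul_comm]
          gcongr ENNReal.ofReal (?_ * _)
          exact Real.rpow_le_rpow_of_nonpos hδ (by nlinarith) (by linarith)
      _ ≤ ∫⁻ s in Set.Ioc (0 : ℝ) δ, ENNReal.ofReal (δ ^ (-q)) * ENNReal.ofReal (s ^ (p - 1)) :=
          MeasureTheory.lintegral_mono_set Set.inter_subset_right
      _ = _ := by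
          rw [MeasureTheory.lintegral_const_mul' _ _ ENNReal.ofReal_ne_top,
            lintegral_Ioc_rpow hp hδ, ← ENNReal.ofReal_mul hδq, sub_eq_add_neg p q,
            Real.rpow_add hδ]
          congr 1
          ring
  have h2 : ∫⁻ s in Set.Ioo (0 : ℝ) 1 ∩ Set.Ioi δ,
      ENNReal.ofReal (s ^ (p - 1) * (1 - (1 - δ) * (1 - s)) ^ (-q)) ≤
      ENNReal.ofReal (1 / (q - p) * δ ^ (p - q)) := by
    calc _ ≤ ∫⁻ s in Set.Ioo (0 : ℝ) 1 ∩ Set.Ioi δ, ENNReal.ofReal (s ^ (-(q - p) - 1)) := by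
          refine MeasureTheory.setLIntegral_mono_ae' (measurableSet_Ioo.inter measurableSet_Ioi)
            (.of_forall fun s hs => ?_)
          have hs0 := hs.1.1
          have hs1 := hs.1.2
          rw [show -(q - p) - 1 = (p - 1) + -q by ring, Real.rpow_add hs0]
          refine ENNReal.ofReal_le_ofReal (mul_le_mul_of_nonneg_left ?_ (by positivity))
          exact Real.rpow_le_rpow_of_nonpos hs0 (by nlinarith) (by linarith)
      _ ≤ ∫⁻ s in Set.Ioi δ, ENNReal.ofReal (s ^ (-(q - p) - 1)) :=
          MeasureTheory.lintegral_mono_set Set.inter_subset_right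
      _ = _ := by
          rw [lintegral_Ioi_rpow (sub_pos.2 hq) hδ, neg_sub]
          congr 1
          ring
  have hqp : 0 < q - p := sub_pos.2 hq
  rw [add_mul, ENNReal.ofReal_add (by positivity) (by positivity)]
  exact add_le_add h1 h2

end KernelIntegrals

/-! ### Kernel powers as test functions for `H^p` and `D^p_{p-1}`. -/

section KernelTest

/-- The function `δ ^ (m - 1 / p) (1 - (1 - δ) ζ̄ z) ^ (-m)`. -/
noncomputable def kernelTest (p : ℝ) (m : ℕ) (δ : ℝ) (ζ z : ℂ) : ℂ :=
  ((δ ^ ((m : ℝ) - 1 / p) : ℝ) : ℂ) *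
    ((1 - ((1 - δ : ℝ) : ℂ) * (starRingEnd ℂ) ζ * z) ^ m)⁻¹

variable {p δ : ℝ} {m : ℕ} {ζ z : ℂ}

lemma norm_kernel_point (hδ1 : δ < 1) (hζ : ‖ζ‖ = 1) :
    ‖((1 - δ : ℝ) : ℂ) * (starRingEnd ℂ) ζ‖ = 1 - δ := by
  rw [norm_mul, RCLike.norm_conj, hζ, mul_one, Complex.norm_real,
    Real.norm_of_nonneg (sub_nonneg.2 hδ1.le)]

lemma le_norm_kernel_base (hδ1 : δ < 1) (hζ : ‖ζ‖ = 1) (z : ℂ) :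
    1 - (1 - δ) * ‖z‖ ≤ ‖1 - ((1 - δ : ℝ) : ℂ) * (starRingEnd ℂ) ζ * z‖ := by
  have := norm_sub_norm_le (1 : ℂ) (((1 - δ : ℝ) : ℂ) * (starRingEnd ℂ) ζ * z)
  rwa [norm_one, norm_mul, norm_kernel_point hδ1 hζ] at this

lemma kernel_base_pos (hδ : 0 < δ) (hδ1 : δ < 1) (hζ : ‖ζ‖ = 1) (hz : ‖z‖ ≤ 1) :
    0 < ‖1 - ((1 - δ : ℝ) : ℂ) * (starRingEnd ℂ) ζ * z‖ :=
  lt_of_lt_of_le (by nlinarith [norm_nonneg z]) (le_norm_kernel_base hδ1 hζ z)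

lemma norm_kernelTest (hδ : 0 < δ) : ‖kernelTest p m δ ζ z‖ = δ ^ ((m : ℝ) - 1 / p) *
    (‖1 - ((1 - δ : ℝ) : ℂ) * (starRingEnd ℂ) ζ * z‖ ^ m)⁻¹ := by
  rw [kernelTest, norm_mul, norm_inv, norm_pow, Complex.norm_real,
    Real.norm_of_nonneg (by positivity)]

lemma hasDerivAt_kernelTest (hδ : 0 < δ) (hδ1 : δ < 1) (hζ : ‖ζ‖ = 1) (hz : ‖z‖ ≤ 1) :
    HasDerivAt (kernelTest p m δ ζ) (((δ ^ ((m : ℝ) - 1 / p) : ℝ) : ℂ) *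
      (m * (((1 - δ : ℝ) : ℂ) * (starRingEnd ℂ) ζ) *
        ((1 - ((1 - δ : ℝ) : ℂ) * (starRingEnd ℂ) ζ * z) ^ (m + 1))⁻¹)) z := by
  have hne : 1 - ((1 - δ : ℝ) : ℂ) * (starRingEnd ℂ) ζ * z ≠ 0 :=
    norm_pos_iff.1 (kernel_base_pos hδ hδ1 hζ hz)
  set a := ((1 - δ : ℝ) : ℂ) * (starRingEnd ℂ) ζ
  have h1 : HasDerivAt (fun z => 1 - a * z) (-a) z := by
    simpa using ((hasDerivAt_id z).const_mul a).const_sub 1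
  have h2 := ((h1.fun_pow m).fun_inv (pow_ne_zero m hne)).const_mul
    (((δ ^ ((m : ℝ) - 1 / p) : ℝ) : ℂ))
  refine h2.congr_deriv ?_
  congr 1
  rcases m with _ | k
  · simp
  · rw [Nat.add_sub_cancel]
    field_simp
    ring

lemma kernelTest_mem_analyticDisc (hδ : 0 < δ) (hδ1 : δ < 1) (hζ : ‖ζ‖ = 1) :
    kernelTest p m δ ζ ∈ analyticDisc := fun z hz =>
  (hasDerivAt_kernelTest hδ hδ1 hζ
    (by simpa using (mem_ball_zero_iff.1 hz).le)).differentiableAt.differentiableWithinAt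

lemma norm_deriv_kernelTest_le (hδ : 0 < δ) (hδ1 : δ < 1) (hζ : ‖ζ‖ = 1) (hz : ‖z‖ ≤ 1) :
    ‖deriv (kernelTest p m δ ζ) z‖ ≤ m * δ ^ ((m : ℝ) - 1 / p) *
      (‖1 - ((1 - δ : ℝ) : ℂ) * (starRingEnd ℂ) ζ * z‖ ^ (m + 1))⁻¹ := by
  rw [(hasDerivAt_kernelTest hδ hδ1 hζ hz).deriv, norm_mul, norm_mul, norm_mul,
    norm_kernel_point hδ1 hζ, norm_inv, norm_pow, Complex.norm_real,
    Real.norm_of_nonneg (by positivity), Complex.norm_natCast]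
  have h : (m : ℝ) * (1 - δ) ≤ m := mul_le_of_le_one_right (by positivity) (by linarith)
  rw [mul_comm (m : ℝ) (δ ^ _), mul_assoc (δ ^ _)]
  gcongr

lemma rpow_kernel_coeff (hp : 0 < p) (hδ : 0 < δ) :
    (δ ^ ((m : ℝ) - 1 / p)) ^ p = δ ^ (m * p - 1) := by
  rw [← Real.rpow_mul hδ.le]
  congr 1
  field_simp

lemma inv_pow_rpow {x : ℝ} (hx : 0 ≤ x) (k : ℕ) (p : ℝ) : ((x ^ k)⁻¹) ^ p = x ^ (-(k * p)) := by
  rw [Real.inv_rpow (by positivity), Real.rpow_neg hx, ← Real.rpow_natCast, ← Real.rpow_mul hx]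

/-- The normalization contributes `δ ^ (mp - 1)`, which cancels the bound `δ ^ (1 - mp)` for the
circle integrals. -/
lemma hardyNorm_kernelTest_le (hp : 0 < p) (hm : 2 ≤ m * p) (hδ : 0 < δ) (hδ1 : δ < 1)
    (hζ : ‖ζ‖ = 1) : hardyNorm p (kernelTest p m δ ζ) ≤ 1 := by
  refine iSup₂_le fun r hr => ?_
  set a := ((1 - δ : ℝ) : ℂ) * (starRingEnd ℂ) ζ with ha
  have har : ‖a * r‖ ≤ 1 - δ := by
    rw [norm_mul, norm_kernel_point hδ1 hζ, Complex.norm_real, Real.norm_of_nonneg hr.1.le]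
    nlinarith [hr.1, hr.2]
  have h1 : ∫⁻ θ in Set.Ioc (0 : ℝ) (2 * Real.pi),
      ‖kernelTest p m δ ζ ((r : ℂ) * Complex.exp ((θ : ℂ) * Complex.I))‖ₑ ^ p ≤
      ENNReal.ofReal (2 * Real.pi) := by
    calc _ = ∫⁻ θ in Set.Ioc (0 : ℝ) (2 * Real.pi), ENNReal.ofReal (δ ^ (m * p - 1)) *
          ENNReal.ofReal (‖1 - a * r * Complex.exp ((θ : ℂ) * Complex.I)‖ ^ (-(m * p))) := by
          refine MeasureTheory.lintegral_congr fun θ => ?_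
          rw [← ofReal_norm, norm_kernelTest hδ, ENNReal.ofReal_rpow_of_nonneg (by positivity) hp.le,
            Real.mul_rpow (by positivity) (by positivity), rpow_kernel_coeff hp hδ,
            inv_pow_rpow (norm_nonneg _), ENNReal.ofReal_mul (by positivity), ← ha, ← mul_assoc]
      _ ≤ ENNReal.ofReal (δ ^ (m * p - 1)) *
          ENNReal.ofReal (2 * Real.pi * (1 - ‖a * r‖) ^ (1 - m * p)) := by
          rw [MeasureTheory.lintegral_const_mul' _ _ ENNReal.ofReal_ne_top]
          gcongr
          exact lintegral_norm_one_sub_rpow_le (by linarith) hm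
      _ ≤ ENNReal.ofReal (δ ^ (m * p - 1) * (2 * Real.pi * δ ^ (1 - m * p))) := by
          rw [ENNReal.ofReal_mul (p := δ ^ (m * p - 1)) (by positivity)]
          refine mul_le_mul_right (ENNReal.ofReal_le_ofReal
            (mul_le_mul_of_nonneg_left ?_ Real.two_pi_pos.le)) _
          exact Real.rpow_le_rpow_of_nonpos hδ (by linarith) (by linarith)
      _ = _ := by
          rw [mul_left_comm, ← Real.rpow_add hδ]
          simp
  rw [integralMean]
  refine ENNReal.rpow_le_one ?_ (by positivity)
  calc _ ≤ ENNReal.ofReal (1 / (2 * Real.pi)) * ENNReal.ofReal (2 * Real.pi) := by gcongr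
    _ = 1 := by
      rw [← ENNReal.ofReal_mul (by positivity), one_div_mul_cancel Real.two_pi_pos.ne',
        ENNReal.ofReal_one]

/-- Differentiation raises the kernel exponent to `(m+1)p`. The circle integral lowers it by 1, and
the radial estimate with `q = (m+1)p - 1` leaves `δ ^ (1 - mp)`, cancelled by the normalization. -/
lemma lintegral_deriv_kernelTest_le (hp : 0 < p) (hm : 2 ≤ m * p) (hδ : 0 < δ)
    (hδ1 : δ < 1) (hζ : ‖ζ‖ = 1) :
    ∫⁻ z in Metric.ball (0 : ℂ) 1, ‖deriv (kernelTest p m δ ζ) z‖ₑ ^ p *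
      ENNReal.ofReal ((1 - ‖z‖) ^ (p - 1)) ≤
      ENNReal.ofReal ((m : ℝ) ^ p * (2 * Real.pi) * (1 / p + 1 / (m * p - 1))) := by
  set a := ((1 - δ : ℝ) : ℂ) * (starRingEnd ℂ) ζ with ha
  have hmp : 0 < (m : ℝ) * p - 1 := by linarith
  rw [lintegral_ball_polar (by fun_prop)]
  have hq : (2 : ℝ) ≤ ((m + 1 : ℕ) : ℝ) * p := by push_cast; nlinarith
  set A : ℝ := (m : ℝ) ^ p * δ ^ (m * p - 1) with hA
  have hA0 : 0 ≤ A := by positivity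
  have h1 : ∀ r ∈ Set.Ioo (0 : ℝ) 1, ENNReal.ofReal r *
      ∫⁻ θ in Set.Ioc (0 : ℝ) (2 * Real.pi),
        ‖deriv (kernelTest p m δ ζ) ((r : ℂ) * Complex.exp ((θ : ℂ) * Complex.I))‖ₑ ^ p *
        ENNReal.ofReal ((1 - ‖(r : ℂ) * Complex.exp ((θ : ℂ) * Complex.I)‖) ^ (p - 1)) ≤
      ENNReal.ofReal (A * (2 * Real.pi)) * ENNReal.ofReal ((1 - r) ^ (p - 1) *
        (1 - (1 - δ) * r) ^ (-(((m + 1 : ℕ) : ℝ) * p - 1))) := by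
    intro r hr
    have hr1 : 0 < 1 - r := sub_pos.2 hr.2
    have har : ‖a * r‖ = (1 - δ) * r := by
      rw [norm_mul, norm_kernel_point hδ1 hζ, Complex.norm_real, Real.norm_of_nonneg hr.1.le]
    have har1 : (1 - δ) * r < 1 := by nlinarith [hr.1, hr.2]
    refine (mul_le_of_le_one_left bot_le (ENNReal.ofReal_le_one.2 hr.2.le)).trans ?_
    calc _ ≤ ∫⁻ θ in Set.Ioc (0 : ℝ) (2 * Real.pi), ENNReal.ofReal (A * (1 - r) ^ (p - 1)) *
          ENNReal.ofReal (‖1 - a * r * Complex.exp ((θ : ℂ) * Complex.I)‖ ^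
            (-(((m + 1 : ℕ) : ℝ) * p))) := by
          refine MeasureTheory.lintegral_mono fun θ => ?_
          have hn : ‖(r : ℂ) * Complex.exp ((θ : ℂ) * Complex.I)‖ = r := by
            rw [norm_mul, Complex.norm_exp_ofReal_mul_I, mul_one, Complex.norm_real,
              Real.norm_of_nonneg hr.1.le]
          have h2 := Real.rpow_le_rpow (norm_nonneg _) (norm_deriv_kernelTest_le (p := p) (m := m)
            hδ hδ1 hζ (hn.trans_le hr.2.le)) hp.le
          rw [Real.mul_rpow (by positivity) (by positivity),
            Real.mul_rpow (by positivity) (by positivity), rpow_kernel_coeff hp hδ,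
            inv_pow_rpow (norm_nonneg _), ← ha, ← mul_assoc, ← hA] at h2
          rw [hn, ← ofReal_norm, ENNReal.ofReal_rpow_of_nonneg (norm_nonneg _) hp.le,
            ← ENNReal.ofReal_mul (by positivity), ← ENNReal.ofReal_mul (by positivity)]
          refine ENNReal.ofReal_le_ofReal ?_
          rw [mul_right_comm]
          exact mul_le_mul_of_nonneg_right h2 (by positivity)
      _ ≤ ENNReal.ofReal (A * (1 - r) ^ (p - 1)) * ENNReal.ofReal (2 * Real.pi *
          (1 - ‖a * r‖) ^ (1 - ((m + 1 : ℕ) : ℝ) * p)) := by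
          rw [MeasureTheory.lintegral_const_mul' _ _ ENNReal.ofReal_ne_top]
          gcongr
          exact lintegral_norm_one_sub_rpow_le (har.trans_lt har1) hq
      _ = _ := by
          rw [← ENNReal.ofReal_mul (by positivity), ← ENNReal.ofReal_mul (by positivity), har,
            neg_sub]
          congr 1
          ring
  refine (MeasureTheory.setLIntegral_mono_ae' measurableSet_Ioo (.of_forall h1)).trans ?_
  rw [MeasureTheory.lintegral_const_mul' _ _ ENNReal.ofReal_ne_top]
  refine (mul_le_mul_right (lintegral_weight_mul_rpow_le (q := ((m + 1 : ℕ) : ℝ) * p - 1) hp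
    (by push_cast; linarith) hδ hδ1) _).trans (le_of_eq ?_)
  rw [← ENNReal.ofReal_mul (by positivity)]
  congr 1
  have h3 : δ ^ (m * p - 1) * δ ^ (p - (((m + 1 : ℕ) : ℝ) * p - 1)) = 1 := by
    rw [← Real.rpow_add hδ]
    push_cast
    ring_nf
    exact Real.rpow_zero δ
  rw [show ((m + 1 : ℕ) : ℝ) * p - 1 - p = m * p - 1 by push_cast; ring]
  linear_combination (m : ℝ) ^ p * (2 * Real.pi) * (1 / p + 1 / (m * p - 1)) * h3

lemma dirichletNorm_kernelTest_le (hp : 0 < p) (hm : 2 ≤ m * p) (hδ : 0 < δ)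
    (hδ1 : δ < 1) (hζ : ‖ζ‖ = 1) : dirichletNorm p (kernelTest p m δ ζ) ≤
      ENNReal.ofReal (((m : ℝ) ^ p * 2 * (1 / p + 1 / (m * p - 1)) + 1) ^ (1 / p)) := by
  have hmp : 0 < (m : ℝ) * p - 1 := by linarith
  have h0 : ‖kernelTest p m δ ζ 0‖ₑ ^ p ≤ 1 := by
    rw [← ofReal_norm, norm_kernelTest hδ, ENNReal.ofReal_rpow_of_nonneg (by positivity) hp.le,
      mul_zero, sub_zero, norm_one, one_pow, inv_one, mul_one, rpow_kernel_coeff hp hδ]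
    exact ENNReal.ofReal_le_one.2 (Real.rpow_le_one hδ.le hδ1.le hmp.le)
  rw [dirichletNorm, ← ENNReal.ofReal_rpow_of_nonneg (by positivity) (by positivity)]
  refine ENNReal.rpow_le_rpow ?_ (by positivity)
  rw [ENNReal.ofReal_add (by positivity) zero_le_one, ENNReal.ofReal_one]
  refine add_le_add ((mul_le_mul_right
    (lintegral_deriv_kernelTest_le hp hm hδ hδ1 hζ) _).trans (le_of_eq ?_)) h0
  rw [← ENNReal.ofReal_mul (by positivity)]
  congr 1
  field_simp

/-- At `(1 - δ) ζ` the base is `1 - (1 - δ)^2 ≤ 2δ`, so the function has size at least `2^(-m)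
δ^(-1/p)` there. Since `m > 1/p`, the factor `δ ^ (m - 1/p)` gives the local decay. -/
lemma isTestFamily_kernelTest {N : (ℂ → ℂ) → ℝ≥0∞} {C : ℝ≥0} (hp : 0 < p) (hm : 2 ≤ m * p)
    (hN : ∀ (δ : ℝ) (ζ : ℂ), 0 < δ → δ < 1 → ‖ζ‖ = 1 → N (kernelTest p m δ ζ) ≤ C) :
    IsTestFamily N (fun n => ((2 : ℝ) ^ m)⁻¹ * ((n : ℝ) + 2) ^ (1 / p - 1)) C
      (fun n => kernelTest p m (1 / ((n : ℝ) + 2))) := by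
  have hδ : ∀ n : ℕ, 0 < 1 / ((n : ℝ) + 2) := fun n => by positivity
  have hδ1 : ∀ n : ℕ, 1 / ((n : ℝ) + 2) < 1 := fun n => by
    rw [div_lt_one (by positivity)]
    linarith [Nat.cast_nonneg (α := ℝ) n]
  refine ⟨fun n ζ hζ => kernelTest_mem_analyticDisc (hδ n) (hδ1 n) hζ,
    fun n ζ hζ => hN _ ζ (hδ n) (hδ1 n) hζ, fun n ζ hζ => ?_, fun R hR hR1 => ?_⟩
  · have h0 := hδ n
    have h1 := hδ1 n
    rw [testRadius, norm_kernelTest h0, sub_sub_cancel]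
    have hinv : (n : ℝ) + 2 = (1 / ((n : ℝ) + 2))⁻¹ := by simp
    set δ := 1 / ((n : ℝ) + 2)
    have h2 : ((1 - δ : ℝ) : ℂ) * (starRingEnd ℂ) ζ * (((1 - δ : ℝ) : ℂ) * ζ) =
        (((1 - δ) ^ 2 : ℝ) : ℂ) := by
      have h3 : (starRingEnd ℂ) ζ * ζ = 1 := by
        rw [mul_comm, Complex.mul_conj, Complex.normSq_eq_norm_sq, hζ]
        simp
      push_cast
      linear_combination (1 - (δ : ℂ)) ^ 2 * h3
    have h4 : ‖1 - ((1 - δ : ℝ) : ℂ) * (starRingEnd ℂ) ζ * (((1 - δ : ℝ) : ℂ) * ζ)‖ =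
        1 - (1 - δ) ^ 2 := by
      rw [h2, ← Complex.ofReal_one, ← Complex.ofReal_sub, Complex.norm_real,
        Real.norm_of_nonneg (by nlinarith)]
    rw [h4, hinv, Real.inv_rpow h0.le, ← Real.rpow_neg h0.le]
    have h5 : 0 < 1 - (1 - δ) ^ 2 := by nlinarith
    calc ((2 : ℝ) ^ m)⁻¹ * δ ^ (-(1 / p - 1))
        = δ * (δ ^ ((m : ℝ) - 1 / p) * ((2 * δ) ^ m)⁻¹) := by
          rw [show -(1 / p - 1) = ((m : ℝ) - 1 / p) + 1 - m by ring, Real.rpow_sub h0,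
            Real.rpow_add h0, Real.rpow_one, Real.rpow_natCast, mul_pow, mul_inv]
          ring
      _ ≤ _ := by
          gcongr
          nlinarith
  · have hs : 0 < (m : ℝ) - 1 / p := by
      rw [sub_pos, div_lt_iff₀ hp]
      linarith
    have hlim : Filter.Tendsto (fun n : ℕ => (1 - testRadius n) ^ ((m : ℝ) - 1 / p) *
        ((1 - R) ^ m)⁻¹) Filter.atTop (nhds 0) := by
      have h1 := (tendsto_testRadius.const_sub 1).rpow_const (p := (m : ℝ) - 1 / p) (Or.inr hs.le)
      rw [sub_self, Real.zero_rpow hs.ne'] at h1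
      simpa using h1.mul_const ((1 - R) ^ m)⁻¹
    refine ⟨_, hlim, fun n ζ w hζ hw => ?_⟩
    have h0 := hδ n
    have h1 := hδ1 n
    rw [testRadius, sub_sub_cancel, norm_kernelTest h0]
    have h2 : 1 - R ≤ ‖1 - ((1 - 1 / ((n : ℝ) + 2) : ℝ) : ℂ) * (starRingEnd ℂ) ζ * w‖ :=
      le_trans (by nlinarith [norm_nonneg w]) (le_norm_kernel_base h1 hζ w)
    have h3 : 0 < 1 - R := by linarith
    gcongr

end KernelTest

/-! ### The three spaces together. -/

lemma exists_isTestFamily {X : ℝ → (ℂ → ℂ) → ℝ≥0∞}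
    (hX : X = hardyNorm ∨ X = dirichletNorm ∨ X = hardyLittlewoodNorm) {p : ℝ} (hp : 0 < p)
    (hp1 : p ≤ 1) : ∃ κ : ℝ, 0 < κ ∧ ∃ (C : ℝ≥0) (f : ℕ → ℂ → ℂ → ℂ),
      IsTestFamily (X p) (fun n => κ * ((n : ℝ) + 2) ^ (1 / p - 1)) C f := by
  obtain ⟨m, hm⟩ := exists_nat_ge (2 / p)
  rw [div_le_iff₀ hp] at hm
  rcases hX with rfl | rfl | rfl
  · exact ⟨_, by positivity, 1, _, isTestFamily_kernelTest hp hm fun δ ζ hδ hδ1 hζ =>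
      hardyNorm_kernelTest_le hp hm hδ hδ1 hζ⟩
  · exact ⟨_, by positivity, _, _, isTestFamily_kernelTest hp hm fun δ ζ hδ hδ1 hζ =>
      dirichletNorm_kernelTest_le hp hm hδ hδ1 hζ⟩
  · exact ⟨_, Real.exp_pos _, _, _, isTestFamily_hardyLittlewood hp hp1⟩

lemma isBoundedT_one {X : ℝ → (ℂ → ℂ) → ℝ≥0∞}
    (hX : X = hardyNorm ∨ X = dirichletNorm ∨ X = hardyLittlewoodNorm) {g : ℂ → ℂ}
    (hg : g ∈ analyticDisc) {M : ℝ≥0} (hM : ∀ z : ℂ, ‖z‖ < 1 → ‖deriv g z‖ₑ ≤ M) :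
    IsBoundedT (X 1) g := by
  rcases hX with rfl | rfl | rfl
  · exact isBoundedT_hardy_one hg hM
  · exact isBoundedT_dirichlet_one hg hM
  · exact isBoundedT_hardyLittlewood_one hg hM

lemma exists_enorm_deriv_polynomial_le (P : Polynomial ℂ) :
    ∃ M : ℝ≥0, ∀ z : ℂ, ‖z‖ < 1 → ‖deriv (fun z : ℂ => P.eval z) z‖ₑ ≤ M := by
  obtain ⟨M, hM⟩ := (isCompact_closedBall (0 : ℂ) 1).exists_bound_of_continuousOn
    (f := fun z => P.derivative.eval z) P.derivative.continuous.continuousOn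
  refine ⟨M.toNNReal, fun z hz => ?_⟩
  rw [Polynomial.deriv, ← ofReal_norm]
  exact ENNReal.ofReal_le_ofReal (hM z (by simpa using hz.le))

end Volterra

theorem theorem2 (X : ℝ → (ℂ → ℂ) → ENNReal)
    (hX : X = Volterra.hardyNorm ∨ X = Volterra.dirichletNorm ∨
      X = Volterra.hardyLittlewoodNorm) :
    (∀ P : Polynomial ℂ, (fun z : ℂ => P.eval z) ∈ Volterra.boundedSymbols (X 1)) ∧
    (∀ p : ℝ, 0 < p → p < 1 → Volterra.boundedSymbols (X p) = Volterra.constants) ∧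
    Volterra.compactSymbols (X 1) = Volterra.constants := by
  refine ⟨fun P => ?_, fun p hp hp1 => ?_, ?_⟩
  · obtain ⟨M, hM⟩ := Volterra.exists_enorm_deriv_polynomial_le P
    have hP : (fun z : ℂ => P.eval z) ∈ Volterra.analyticDisc := P.differentiable.differentiableOn
    exact ⟨hP, Volterra.isBoundedT_one hX hP hM⟩
  · obtain ⟨κ, hκ, C, f, hf⟩ := Volterra.exists_isTestFamily hX hp hp1.le
    have hexp : 0 < 1 / p - 1 := by
      rw [sub_pos, lt_div_iff₀ hp]
      linarith
    exact hf.boundedSymbols_eq (((tendsto_rpow_atTop hexp).comp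
      (Filter.tendsto_atTop_add_const_right _ 2 tendsto_natCast_atTop_atTop)).const_mul_atTop hκ)
  · obtain ⟨κ, hκ, C, f, hf⟩ := Volterra.exists_isTestFamily hX one_pos le_rfl
    -- At `p = 1` the growth exponent `1/p - 1` is zero, so the lower bound is the constant `κ`.
    simp only [div_one, sub_self, Real.rpow_zero, mul_one] at hf
    exact hf.compactSymbols_eq hκ
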